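/- Let $\gamma\colon\mathbb{R}\to\mathbb{R}^2$ be a periodic parametrization, of period $\ell>0$, of a closed simple smooth regular plane curve; that is, $\gamma$ is $C^\infty$, $\gamma'(t)\neq 0$ for all $t$, $\gamma(t+\ell)=\gamma(t)$ for all $t$, and $\gamma$ is injective on $[0,\ell)$. Let $C=\gamma(\mathbb{R})$, and let $\mathrm{T}=\gamma'/|\gamma'|$, $\mathrm{N}$ (the rotation of $\mathrm{T}$ by $\pi/2$ counterclockwise) and $k$ be the unit tangent, the unit normal and the signed curvature of $\gamma$. The osculating circline $\sigma_t$ of $\gamma$ at $t$ is the circle of radius $1/|k(t)|$ centered at $\gamma(t)+\tfrac1{k(t)}\mathrm{N}(t)$ if $k(t)\neq 0$, and the tangent line to $\gamma$ at $t$ if $k(t)=0$. It globally supports $\gamma$ at the point $\gamma(t)\in\sigma_t$ if $C$ lies in one of the two closed regions into which $\sigma_t$ divides the plane; it does so from inside (respectively, from outside) if, moreover, $\sigma_t$ lies in the closed bounded (respectively, closed unbounded) region into which $C$ divides the plane. Then there are four distinct points $p_1,p_2,p_3,p_4$ of $C$ such that $\gamma$ is globally supported at $p_1$ and $p_2$ from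 inside, and at $p_3$ and $p_4$ from outside, by its osculating circline at that point. Moreover, $\gamma$ has at least four vertices: there are four distinct points $\gamma(t)$ of $C$ with $k'(t)=0$. -/

import Mathlib

open scoped ContDiff

/-- The Euclidean plane. -/
abbrev Plane : Type := EuclideanSpace ℝ (Fin 2)

/-- `γ` is an `ℓ`-periodic smooth regular parametrization of a closed simple plane curve;
the curve itself, as a set of points, is `Set.range γ`. -/
structure IsSimpleClosedSmoothRegularCurve (γ : ℝ → Plane) (ℓ : ℝ) : Prop where
  smooth : ContDiff ℝ ∞ γ
  regular : ∀ t, deriv γ t ≠ 0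
  period_pos : 0 < ℓ
  periodic : Function.Periodic γ ℓ
  simple : Set.InjOn γ (Set.Ico 0 ℓ)

namespace PlaneCurve

/-- Counterclockwise rotation of the plane by the angle `π / 2`. -/
noncomputable def rotate (v : Plane) : Plane := !₂[-(v 1), v 0]

/-- The unit tangent vector of a regular curve. -/
noncomputable def tangent (γ : ℝ → Plane) (t : ℝ) : Plane := ‖deriv γ t‖⁻¹ • deriv γ t

/-- The unit normal vector: `tangent γ t, normal γ t` is an oriented orthonormal frame. -/
noncomputable def normal (γ : ℝ → Plane) (t : ℝ) : Plane := rotate (tangent γ t)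

/-- The signed curvature of a regular curve: the component along the normal of the derivative
of the unit tangent with respect to arc length. -/
noncomputable def signedCurvature (γ : ℝ → Plane) (t : ℝ) : ℝ :=
  inner ℝ (deriv (tangent γ) t) (normal γ t) / ‖deriv γ t‖

/-- The regular curve `γ` has a vertex at `t`: its signed curvature is critical at `t`. -/
def IsVertexAt (γ : ℝ → Plane) (t : ℝ) : Prop :=
  HasDerivAt (signedCurvature γ) 0 t

/-- The circline (circle or line) through `p` with unit tangent vector `T` at `p` and constant
signed curvature `k`, as a set of points. -/
noncomputable def circline (p T : Plane) (k : ℝ) : Set Plane :=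
  if k = 0 then Set.range (fun s : ℝ => p + s • T)
  else Metric.sphere (p + k⁻¹ • rotate T) |k|⁻¹

/-- The osculating circline of the regular curve `γ` at `t`. -/
noncomputable def osculatingCircline (γ : ℝ → Plane) (t : ℝ) : Set Plane :=
  circline (γ t) (tangent γ t) (signedCurvature γ t)

/-- `R` is one of the closed regions into which the curve `C` divides the plane: a connected
component of the complement of `C`, together with `C`. -/
def IsClosedRegion (C R : Set Plane) : Prop :=
  ∃ x ∈ Cᶜ, R = connectedComponentIn Cᶜ x ∪ C

/-- The points that lie inside the closed curve `C`. -/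
def inside (C : Set Plane) : Set Plane :=
  {x | x ∈ Cᶜ ∧ Bornology.IsBounded (connectedComponentIn Cᶜ x)}

/-- The points that lie outside the closed curve `C`. -/
def outside (C : Set Plane) : Set Plane :=
  {x | x ∈ Cᶜ ∧ ¬ Bornology.IsBounded (connectedComponentIn Cᶜ x)}

/-- The simple proper curve with point set `σ` globally supports the curve with point set `C`
at the point `p`. -/
def GloballySupportsAt (σ C : Set Plane) (p : Plane) : Prop :=
  p ∈ σ ∧ p ∈ C ∧ ∃ R, IsClosedRegion σ R ∧ C ⊆ R

/-- `σ` globally supports the closed simple curve `C` at `p` from inside. -/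
def GloballySupportsFromInsideAt (σ C : Set Plane) (p : Plane) : Prop :=
  GloballySupportsAt σ C p ∧ σ ⊆ inside C ∪ C

/-- `σ` globally supports the closed simple curve `C` at `p` from outside. -/
def GloballySupportsFromOutsideAt (σ C : Set Plane) (p : Plane) : Prop :=
  GloballySupportsAt σ C p ∧ σ ⊆ outside C ∪ C

end PlaneCurve

/-! Identify the plane with `ℂ`. The curve lies where `circlineFun κ (unitNormal c t) (c t) ≤ 0`
exactly when `κ` bounds all chord curvatures at `t`; the least such `κ` is `maxCurvature c ℓ t`. It
gives the largest "disk" (a half-plane or the exterior of a circle when `κ ≤ 0`) that is tangent to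
the curve at `c t` from the left and contains no point of the curve. Its boundary either has the
curvature of `c` at `t`, and is then osculating, or passes through a second point `c s`
(`maxCurvature_eq_or_exists_touches`). So two parameters of the osculating kind are wanted.

`Touches` is an equivalence relation: touching points share one supporting disk (`touches_eq`).
Distinct classes do not cross (`touches_of_interleaved`). If disks through `c a`, `c b` and through
`c m`, `c s` interleaved, subtract from the Cauchy integral over `[a, b]` a primitive of its
derivative, cut along an arc of the first circline that avoids the second disk. The difference is
locally constant, jumps by `2πi` across the curve at `c m` and does not jump at `c s`; yet the two
jumps agree, as the second disk joins the left banks and the right side of the curve joins the right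
banks. By non-crossing, an innermost touching pair degenerates to an osculating point, and each of
the two arcs cut off by a touching pair contains one. Reversal of the orientation gives two supports
from the right.

The same jump supplies the needed part of the Jordan curve theorem: the two sides of the curve are
disjoint; a nearest-point argument shows that they fill the complement, and exactly one is bounded.
Finally, at a supporting osculating circline a function of constant sign vanishes along the curve to
second order, so its third-order term, a positive multiple of the derivative of the curvature,
vanishes (`hasDerivAt_curvature_zero`). -/

namespace PlaneCurve

open Set Filter Topology Complex

/-! ### Cauchy integrals along an arc: derivative and jump. -/

/-- The Cauchy integral `∫ dz / (z - x)` along the path `c` restricted to `[a, b]`. -/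
noncomputable def cauchyIntegral (c : ℝ → ℂ) (a b : ℝ) (x : ℂ) : ℂ :=
  ∫ t in a..b, deriv c t / (c t - x)

section CauchyIntegral

variable {c : ℝ → ℂ} {a b : ℝ}

theorem intervalIntegrable_cauchyIntegrand (hc : ContDiff ℝ 1 c) {x : ℂ}
    (hx : ∀ t ∈ uIcc a b, c t ≠ x) :
    IntervalIntegrable (fun t => deriv c t / (c t - x)) MeasureTheory.volume a b :=
  ContinuousOn.intervalIntegrable <|
    (hc.continuous_deriv le_rfl).continuousOn.div
      (hc.continuous.sub continuous_const).continuousOn fun t ht => sub_ne_zero.2 (hx t ht)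

theorem hasDerivAt_log_sub_div (hc : ContDiff ℝ 1 c) {x w : ℂ} {t : ℝ}
    (h : (c t - x) / w ∈ slitPlane) :
    HasDerivAt (fun t => log ((c t - x) / w)) (deriv c t / (c t - x)) t := by
  have hw : w ≠ 0 := by
    rintro rfl
    simp at h
  have h1 : HasDerivAt (fun t => (c t - x) / w) (deriv c t / w) t :=
    (((hc.differentiable one_ne_zero t).hasDerivAt).sub_const x).div_const w
  have h2 := h1.clog_real h
  rwa [div_div_div_cancel_right₀ hw] at h2

theorem cauchyIntegral_eq_log_sub_log (hc : ContDiff ℝ 1 c) {x w : ℂ}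
    (h : ∀ t ∈ uIcc a b, (c t - x) / w ∈ slitPlane) :
    cauchyIntegral c a b x = log ((c b - x) / w) - log ((c a - x) / w) := by
  refine intervalIntegral.integral_eq_sub_of_hasDerivAt
    (fun t ht => hasDerivAt_log_sub_div hc (h t ht)) (intervalIntegrable_cauchyIntegrand hc ?_)
  intro t ht hx
  have := h t ht
  simp [hx] at this

/-- Since `x` is closer to `y` than the path is, `(c t - x) / (c t - y)` stays within distance 1 of
1, and the principal logarithm serves along the whole path. -/
theorem cauchyIntegral_sub_eq_log_sub_log (hc : ContDiff ℝ 1 c) {x y : ℂ}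
    (hxy : ∀ t ∈ uIcc a b, ‖x - y‖ < ‖c t - y‖) :
    cauchyIntegral c a b x - cauchyIntegral c a b y =
      log ((c b - x) / (c b - y)) - log ((c a - x) / (c a - y)) := by
  have hy : ∀ t ∈ uIcc a b, c t ≠ y := fun t ht h => by
    have := hxy t ht
    rw [h, sub_self, norm_zero] at this
    exact absurd this (norm_nonneg _).not_gt
  have hx : ∀ t ∈ uIcc a b, c t ≠ x := fun t ht h => by
    have := hxy t ht
    rw [h] at this
    exact lt_irrefl _ this
  rw [cauchyIntegral, cauchyIntegral, ← intervalIntegral.integral_sub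
    (intervalIntegrable_cauchyIntegrand hc hx) (intervalIntegrable_cauchyIntegrand hc hy)]
  refine intervalIntegral.integral_eq_sub_of_hasDerivAt
    (f := fun t => log ((c t - x) / (c t - y))) (fun t ht => ?_)
    ((intervalIntegrable_cauchyIntegrand hc hx).sub (intervalIntegrable_cauchyIntegrand hc hy))
  have h1 := (hc.differentiable one_ne_zero t).hasDerivAt
  have hyt := sub_ne_zero.2 (hy t ht)
  have hxt := sub_ne_zero.2 (hx t ht)
  have h2 := (h1.sub_const x).div (h1.sub_const y) hyt
  have hs : (c t - x) / (c t - y) ∈ slitPlane := by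
    have : (c t - x) / (c t - y) = 1 + (y - x) / (c t - y) := by field_simp; ring
    rw [this]
    refine mem_slitPlane_of_norm_lt_one ?_
    rw [norm_div, div_lt_one (norm_pos_iff.2 hyt), norm_sub_rev]
    exact hxy t ht
  refine (h2.clog_real hs).congr_deriv ?_
  rw [Pi.div_apply]
  field_simp

theorem isClosed_image_uIcc (hc : Continuous c) : IsClosed (c '' uIcc a b) :=
  (isCompact_uIcc.image hc).isClosed

/-- Only the endpoints contribute, so for a closed path the integral is locally constant off the
path. -/
theorem hasDerivAt_cauchyIntegral (hc : ContDiff ℝ 1 c) {y : ℂ} (hy : y ∉ c '' uIcc a b) :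
    HasDerivAt (cauchyIntegral c a b) (1 / (c a - y) - 1 / (c b - y)) y := by
  obtain ⟨r, hr, hball⟩ := Metric.isOpen_iff.1
    (isClosed_image_uIcc (a := a) (b := b) hc.continuous).isOpen_compl y hy
  have key : cauchyIntegral c a b =ᶠ[𝓝 y] fun x => cauchyIntegral c a b y +
      (log ((c b - x) / (c b - y)) - log ((c a - x) / (c a - y))) := by
    filter_upwards [Metric.ball_mem_nhds y hr] with x hx
    rw [← cauchyIntegral_sub_eq_log_sub_log hc, add_sub_cancel]
    intro t ht
    rw [Metric.mem_ball, dist_eq_norm] at hx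
    refine hx.trans_le (not_lt.1 fun h => ?_)
    refine hball (?_ : c t ∈ Metric.ball y r) ⟨t, ht, rfl⟩
    rwa [Metric.mem_ball, dist_eq_norm]
  have hlog : ∀ t ∈ uIcc a b,
      HasDerivAt (fun x => log ((c t - x) / (c t - y))) (-1 / (c t - y)) y := by
    intro t ht
    have hyt : c t - y ≠ 0 := sub_ne_zero.2 fun h => hy ⟨t, ht, h⟩
    have h1 : HasDerivAt (fun x => (c t - x) / (c t - y)) (-1 / (c t - y)) y :=
      ((hasDerivAt_id y).const_sub (c t)).div_const _
    have h2 := h1.clog (by rw [div_self hyt]; exact one_mem_slitPlane)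
    rwa [div_self hyt, div_one] at h2
  have := ((hlog b right_mem_uIcc).sub (hlog a left_mem_uIcc)).const_add (cauchyIntegral c a b y)
  refine (this.congr_of_eventuallyEq key).congr_deriv ?_
  ring

theorem cauchyIntegral_add (hc : ContDiff ℝ 1 c) {d : ℝ} {x : ℂ}
    (h1 : ∀ t ∈ uIcc a b, c t ≠ x) (h2 : ∀ t ∈ uIcc b d, c t ≠ x) :
    cauchyIntegral c a b x + cauchyIntegral c b d x = cauchyIntegral c a d x :=
  intervalIntegral.integral_add_adjacent_intervals
    (intervalIntegrable_cauchyIntegrand hc h1) (intervalIntegrable_cauchyIntegrand hc h2)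

theorem log_sub_log_neg_of_im_pos {z : ℂ} (hz : 0 < z.im) :
    log z - log (-z) = Real.pi * I := by
  rw [log, log, norm_neg, arg_neg_eq_arg_sub_pi_of_im_pos hz]
  push_cast
  ring

theorem log_sub_log_neg_of_im_neg {z : ℂ} (hz : z.im < 0) :
    log z - log (-z) = -(Real.pi * I) := by
  rw [log, log, norm_neg, arg_neg_eq_arg_add_pi_of_im_neg hz]
  push_cast
  ring

/-- The jump of the Cauchy integral across a path whose component along `T` is increasing. -/
theorem tendsto_cauchyIntegral_jump_of_sign (hc : ContDiff ℝ 1 c) {m : ℝ} {T : ℂ} (hT : T ≠ 0)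
    (ham : a < m) (hmb : m < b)
    (hneg : ∀ t ∈ Ico a m, ((c t - c m) / T).re < 0)
    (hpos : ∀ t ∈ Ioc m b, 0 < ((c t - c m) / T).re) :
    Tendsto (fun ε : ℝ => cauchyIntegral c a b (c m + ε * (I * T)) -
      cauchyIntegral c a b (c m - ε * (I * T))) (𝓝[>] 0) (𝓝 (2 * Real.pi * I)) := by
  have hab : uIcc a b = Icc a b := uIcc_of_le (ham.trans hmb).le
  have hIT : I * T ≠ 0 := mul_ne_zero I_ne_zero hT
  -- Division by `∓(I * T)` turns the branch cut away from the path as seen from the shifted point: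
  -- up to sign, the imaginary part is the component of `c t - c m` along `T`, zero only at `t = m`,
  -- where the quotient is positive.
  have him : ∀ (t η : ℝ), ((c t - (c m + η * (I * T))) / -(I * T)).im = ((c t - c m) / T).re := by
    intro t η
    have : (c t - (c m + η * (I * T))) / -(I * T) = (c t - c m) / T * I + (η : ℂ) := by
      field_simp
      linear_combination (-(c t - c m)) * I_sq
    simp [this]
  have hslit : ∀ η : ℝ, 0 < η → ∀ t ∈ uIcc a b,
      (c t - (c m + η * (I * T))) / -(I * T) ∈ slitPlane := by
    intro η hη t ht
    rw [hab] at ht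
    rcases lt_trichotomy t m with h | h | h
    · exact Or.inr (by rw [him]; exact (hneg t ⟨ht.1, h⟩).ne)
    · left
      rw [h, show (c m - (c m + η * (I * T))) / -(I * T) = (η : ℂ) by field_simp; ring]
      simpa
    · exact Or.inr (by rw [him]; exact (hpos t ⟨h, ht.2⟩).ne')
  have hslit' : ∀ η : ℝ, 0 < η → ∀ t ∈ uIcc a b,
      (c t - (c m - η * (I * T))) / (I * T) ∈ slitPlane := by
    intro η hη t ht
    rw [hab] at ht
    have e : (c t - (c m - η * (I * T))) / (I * T) =
        -((c t - (c m + ((-η : ℝ) : ℂ) * (I * T))) / -(I * T)) := by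
      push_cast
      rw [div_neg, neg_neg]
      ring
    rcases lt_trichotomy t m with h | h | h
    · right
      rw [e, neg_im, him]
      exact (neg_pos.2 (hneg t ⟨ht.1, h⟩)).ne'
    · left
      rw [h, show (c m - (c m - η * (I * T))) / (I * T) = (η : ℂ) by field_simp; ring]
      simpa
    · right
      rw [e, neg_im, him]
      exact (neg_neg_iff_pos.2 (hpos t ⟨h, ht.2⟩)).ne
  have key : ∀ᶠ ε : ℝ in 𝓝[>] 0,
      (log ((c b - (c m + ε * (I * T))) / -(I * T)) - log ((c a - (c m + ε * (I * T))) / -(I * T)))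
      - (log ((c b - (c m - ε * (I * T))) / (I * T)) - log ((c a - (c m - ε * (I * T))) / (I * T)))
      = cauchyIntegral c a b (c m + ε * (I * T)) - cauchyIntegral c a b (c m - ε * (I * T)) := by
    filter_upwards [self_mem_nhdsWithin] with ε hε
    rw [cauchyIntegral_eq_log_sub_log hc (hslit ε hε), cauchyIntegral_eq_log_sub_log hc (hslit' ε hε)]
  refine Tendsto.congr' key ?_
  have him0 : ∀ t, ((c t - c m) / -(I * T)).im = ((c t - c m) / T).re := by
    intro t
    have := him t 0
    rwa [ofReal_zero, zero_mul, add_zero] at this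
  have hb := hpos b ⟨hmb, le_rfl⟩
  have ha := hneg a ⟨le_rfl, ham⟩
  rw [← him0] at hb ha
  -- In the limit the two branches, with opposite cuts, differ by `πi` at `c b` and by `-πi` at `c
  -- a`.
  have e1 := log_sub_log_neg_of_im_pos hb
  have e2 := log_sub_log_neg_of_im_neg ha
  rw [div_neg, neg_neg] at e1 e2
  have hb' : (c b - c m) / -(I * T) ∈ slitPlane := Or.inr hb.ne'
  have ha' : (c a - c m) / -(I * T) ∈ slitPlane := Or.inr ha.ne
  have hb'' : (c b - c m) / (I * T) ∈ slitPlane := Or.inr (by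
    rw [div_neg, neg_im] at hb
    linarith)
  have ha'' : (c a - c m) / (I * T) ∈ slitPlane := Or.inr (by
    rw [div_neg, neg_im] at ha
    linarith)
  have hlim : ContinuousAt (fun ε : ℝ =>
      (log ((c b - (c m + ε * (I * T))) / -(I * T)) - log ((c a - (c m + ε * (I * T))) / -(I * T)))
      - (log ((c b - (c m - ε * (I * T))) / (I * T)) -
          log ((c a - (c m - ε * (I * T))) / (I * T)))) 0 := by
    refine ((ContinuousAt.clog ?_ ?_).sub (ContinuousAt.clog ?_ ?_)).sub
      ((ContinuousAt.clog ?_ ?_).sub (ContinuousAt.clog ?_ ?_))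
    all_goals first | fun_prop | simpa
  have := hlim.tendsto.mono_left (nhdsWithin_le_nhds (s := Ioi 0))
  convert! this using 2
  rw [ofReal_zero, zero_mul, add_zero, sub_zero, div_neg, div_neg]
  linear_combination -e1 + e2

/-- The jump of the Cauchy integral across the path. -/
theorem tendsto_cauchyIntegral_jump (hc : ContDiff ℝ 1 c) {m : ℝ} (hm : m ∈ Ioo a b) {T : ℂ}
    (hT : T ≠ 0) (hderiv : 0 < (deriv c m / T).re)
    (hinj : ∀ t ∈ Icc a b, c t = c m → t = m) :
    Tendsto (fun ε : ℝ => cauchyIntegral c a b (c m + ε * (I * T)) -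
      cauchyIntegral c a b (c m - ε * (I * T))) (𝓝[>] 0) (𝓝 (2 * Real.pi * I)) := by
  have hd : HasDerivAt (fun t => ((c t - c m) / T).re) (deriv c m / T).re m :=
    reCLM.hasFDerivAt.comp_hasDerivAt m
      ((((hc.differentiable one_ne_zero m).hasDerivAt).sub_const (c m)).div_const T)
  have hs : ∀ᶠ t in 𝓝 m, SignType.sign ((c t - c m) / T).re = SignType.sign (t - m) :=
    eventually_nhdsWithin_sign_eq_of_deriv_pos (f := fun t => ((c t - c m) / T).re)
      (by rw [hd.deriv]; exact hderiv) (by simp)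
  obtain ⟨δ, hδ, hball⟩ := Metric.eventually_nhds_iff.1
    (hs.and (Ioo_mem_nhds hm.1 hm.2))
  obtain ⟨a', ha'⟩ : ∃ a', a' = m - δ / 2 := ⟨_, rfl⟩
  obtain ⟨b', hb'⟩ : ∃ b', b' = m + δ / 2 := ⟨_, rfl⟩
  have hnear : ∀ t ∈ Icc a' b', SignType.sign ((c t - c m) / T).re = SignType.sign (t - m) ∧
      t ∈ Ioo a b := by
    intro t ht
    refine hball ?_
    rw [Real.dist_eq, abs_lt]
    constructor <;> linarith [ht.1, ht.2]
  have haa := (hnear a' ⟨le_rfl, by linarith⟩).2.1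
  have hbb := (hnear b' ⟨by linarith, le_rfl⟩).2.2
  have hmid := tendsto_cauchyIntegral_jump_of_sign (a := a') (b := b') (m := m) hc hT (by linarith)
    (by linarith)
    (fun t ht => by
      have := (hnear t ⟨ht.1, by linarith [ht.2]⟩).1
      rw [sign_neg (sub_neg.2 ht.2)] at this
      exact sign_eq_neg_one_iff.1 this)
    (fun t ht => by
      have := (hnear t ⟨by linarith [ht.1], ht.2⟩).1
      rw [sign_pos (sub_pos.2 ht.1)] at this
      exact sign_eq_one_iff.1 this)
  -- A piece of the path that avoids `c m` has a Cauchy integral continuous at `c m`; the whole jump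
  -- comes from `[a', b']`.
  have hside : ∀ p q : ℝ, p ≤ q → a ≤ p → q ≤ b → m ∉ Icc p q →
      Tendsto (fun ε : ℝ => cauchyIntegral c p q (c m + ε * (I * T)) -
      cauchyIntegral c p q (c m - ε * (I * T))) (𝓝[>] 0) (𝓝 0) := by
    intro p q hpq hp hq hmpq
    have hcont : ContinuousAt (cauchyIntegral c p q) (c m) := by
      refine (hasDerivAt_cauchyIntegral hc ?_).continuousAt
      rintro ⟨t, ht, hte⟩
      rw [uIcc_of_le hpq] at ht
      rw [hinj t ⟨hp.trans ht.1, ht.2.trans hq⟩ hte] at ht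
      exact hmpq ht
    have h1 : ContinuousAt (fun ε : ℝ => cauchyIntegral c p q (c m + ε * (I * T)) -
        cauchyIntegral c p q (c m - ε * (I * T))) 0 := by
      refine ContinuousAt.sub (ContinuousAt.comp (g := cauchyIntegral c p q) ?_ (by fun_prop))
        (ContinuousAt.comp (g := cauchyIntegral c p q) ?_ (by fun_prop)) <;> simpa
    simpa using h1.tendsto.mono_left (nhdsWithin_le_nhds (s := Ioi 0))
  have hleft := hside a a' haa.le le_rfl (by linarith [hm.2]) (fun h => by linarith [h.2])
  have hright := hside b' b hbb.le (by linarith [hm.1]) le_rfl (fun h => by linarith [h.1])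
  -- The integral splits only at points off the path. The outer pieces are compact and miss `c m`;
  -- on `[a', b']` the component along `T` vanishes at `m` alone.
  have hoff : ∀ᶠ ε : ℝ in 𝓝[>] 0, ∀ t ∈ Icc a b, c t ≠ c m + ε * (I * T) ∧
      c t ≠ c m - ε * (I * T) := by
    have hcl : IsClosed (c '' (Icc a a' ∪ Icc b' b)) :=
      ((isCompact_Icc.union isCompact_Icc).image hc.continuous).isClosed
    have hcm : c m ∈ (c '' (Icc a a' ∪ Icc b' b))ᶜ := by
      rintro ⟨t, ht, hte⟩
      have : t = m := hinj t (ht.elim (fun h => ⟨h.1, by linarith [h.2, hm.2]⟩)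
        fun h => ⟨by linarith [h.1, hm.1], h.2⟩) hte
      rcases ht with h | h
      · linarith [h.2]
      · linarith [h.1]
    have hnhds := hcl.isOpen_compl.mem_nhds hcm
    have t1 : Tendsto (fun ε : ℝ => c m + ε * (I * T)) (𝓝[>] 0) (𝓝 (c m)) := by
      have : ContinuousAt (fun ε : ℝ => c m + ε * (I * T)) 0 := by fun_prop
      simpa using this.tendsto.mono_left (nhdsWithin_le_nhds (s := Ioi 0))
    have t2 : Tendsto (fun ε : ℝ => c m - ε * (I * T)) (𝓝[>] 0) (𝓝 (c m)) := by
      have : ContinuousAt (fun ε : ℝ => c m - ε * (I * T)) 0 := by fun_prop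
      simpa using this.tendsto.mono_left (nhdsWithin_le_nhds (s := Ioi 0))
    have hre : ∀ ε : ℝ, (ε * (I * T) / T).re = 0 := fun ε => by
      rw [mul_div_assoc, mul_div_cancel_right₀ _ hT]
      simp
    filter_upwards [t1 hnhds, t2 hnhds, self_mem_nhdsWithin] with ε h1 h2 hε t ht
    have hIT : (ε : ℂ) * (I * T) ≠ 0 :=
      mul_ne_zero (by exact_mod_cast (ne_of_gt hε)) (mul_ne_zero I_ne_zero hT)
    by_cases hta : t ∈ Icc a' b'
    · have hst := (hnear t hta).1
      constructor
      · intro h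
        rw [show c t - c m = ε * (I * T) by rw [h]; ring, hre, sign_zero] at hst
        rw [sub_eq_zero.1 (sign_eq_zero_iff.1 hst.symm)] at h
        exact hIT (by linear_combination -h)
      · intro h
        rw [show c t - c m = -(ε * (I * T)) by rw [h]; ring, neg_div, neg_re, hre, neg_zero,
          sign_zero] at hst
        rw [sub_eq_zero.1 (sign_eq_zero_iff.1 hst.symm)] at h
        exact hIT (by linear_combination h)
    · have hmem : t ∈ Icc a a' ∪ Icc b' b := by
        rw [mem_Icc, not_and_or, not_le, not_le] at hta
        exact hta.imp (fun h => ⟨ht.1, h.le⟩) fun h => ⟨h.le, ht.2⟩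
      exact ⟨fun h => h1 ⟨t, hmem, h⟩, fun h => h2 ⟨t, hmem, h⟩⟩
  have hsum := (hleft.add hmid).add hright
  rw [zero_add, add_zero] at hsum
  refine hsum.congr' ?_
  filter_upwards [hoff] with ε hε
  have hle : a' ≤ b' := by linarith
  have split : ∀ x : ℂ, (∀ t ∈ Icc a b, c t ≠ x) → cauchyIntegral c a b x =
      cauchyIntegral c a a' x + cauchyIntegral c a' b' x + cauchyIntegral c b' b x := by
    intro x hx
    rw [cauchyIntegral_add hc, cauchyIntegral_add hc]
    all_goals
      intro t ht
      rw [uIcc_of_le (by linarith)] at ht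
      exact hx t ⟨by linarith [ht.1], by linarith [ht.2]⟩
  rw [split _ fun t ht => (hε t ht).1, split _ fun t ht => (hε t ht).2]
  ring

end CauchyIntegral

/-! ### Simple loops in `ℂ`, their frame and chord curvature. -/

/-- `c` is an `ℓ`-periodic smooth regular parametrization of a simple closed curve in `ℂ`. -/
structure IsSimpleLoop (c : ℝ → ℂ) (ℓ : ℝ) : Prop where
  smooth : ContDiff ℝ ∞ c
  regular : ∀ t, deriv c t ≠ 0
  period_pos : 0 < ℓ
  periodic : Function.Periodic c ℓ
  simple : InjOn c (Ico 0 ℓ)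

/-- The unit tangent vector of a curve in `ℂ`. -/
noncomputable def unitTangent (c : ℝ → ℂ) (t : ℝ) : ℂ := ‖deriv c t‖⁻¹ • deriv c t

/-- The unit normal vector of a curve in `ℂ`. -/
noncomputable def unitNormal (c : ℝ → ℂ) (t : ℝ) : ℂ := I * unitTangent c t

/-- The signed curvature of a curve in `ℂ`. -/
noncomputable def curvature (c : ℝ → ℂ) (t : ℝ) : ℝ :=
  inner ℝ (deriv (unitTangent c) t) (unitNormal c t) / ‖deriv c t‖

/-- The function whose zero set is the circline of curvature `κ` through `p` with normal `n` at
`p`; it is positive on the side of `n`. -/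
def circlineFun (κ : ℝ) (n p x : ℂ) : ℝ :=
  2 * (n.re * (x.re - p.re) + n.im * (x.im - p.im)) -
    κ * ((x.re - p.re) ^ 2 + (x.im - p.im) ^ 2)

/-- The average velocity of `c` between the times `t` and `t + h`. -/
noncomputable def meanVelocity (c : ℝ → ℂ) (t h : ℝ) : ℂ :=
  ∫ u in (0 : ℝ)..1, deriv c (t + u * h)

/-- The second order Taylor remainder of `c` at `t`, divided by `h ^ 2`. -/
noncomputable def meanAcceleration (c : ℝ → ℂ) (t h : ℝ) : ℂ :=
  ∫ u in (0 : ℝ)..1, (1 - u) • deriv (deriv c) (t + u * h)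

/-- The signed curvature of the circline that is tangent to `c` at `t` and passes through
`c (t + h)`; for `h = 0` it is the curvature of `c`. -/
noncomputable def chordCurvature (c : ℝ → ℂ) (t h : ℝ) : ℝ :=
  2 * ((unitNormal c t).re * (meanAcceleration c t h).re +
    (unitNormal c t).im * (meanAcceleration c t h).im) /
    ((meanVelocity c t h).re ^ 2 + (meanVelocity c t h).im ^ 2)

/-- The largest curvature of a circline that is tangent to `c` at `t` and meets `c` again. -/
noncomputable def maxCurvature (c : ℝ → ℂ) (ℓ t : ℝ) : ℝ :=
  sSup ((fun h => chordCurvature c t (max (-(ℓ / 2)) (min (ℓ / 2) h))) '' Icc (-(ℓ / 2)) (ℓ / 2))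

theorem re_sq_add_im_sq_ne_zero {z : ℂ} (hz : z ≠ 0) : z.re ^ 2 + z.im ^ 2 ≠ 0 := by
  have := normSq_pos.2 hz
  rw [normSq_apply] at this
  nlinarith

namespace IsSimpleLoop

variable {c : ℝ → ℂ} {ℓ : ℝ} (hc : IsSimpleLoop c ℓ)
include hc

theorem contDiff_deriv : ContDiff ℝ ∞ (deriv c) :=
  (contDiff_infty_iff_deriv.1 hc.smooth).2

theorem contDiff_one : ContDiff ℝ 1 c := hc.smooth.of_le (by exact_mod_cast le_top)

theorem continuous : Continuous c := hc.smooth.continuous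

theorem hasDerivAt (t : ℝ) : HasDerivAt c (deriv c t) t :=
  (hc.contDiff_one.differentiable one_ne_zero t).hasDerivAt

theorem hasDerivAt_deriv (t : ℝ) : HasDerivAt (deriv c) (deriv (deriv c) t) t :=
  (hc.contDiff_deriv.differentiable (by simp) t).hasDerivAt

theorem norm_deriv_pos (t : ℝ) : 0 < ‖deriv c t‖ := norm_pos_iff.2 (hc.regular t)

theorem contDiff_norm_deriv : ContDiff ℝ ∞ fun t => ‖deriv c t‖ :=
  hc.contDiff_deriv.norm ℝ hc.regular

theorem contDiff_unitTangent : ContDiff ℝ ∞ (unitTangent c) :=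
  (hc.contDiff_norm_deriv.inv fun t => (hc.norm_deriv_pos t).ne').smul hc.contDiff_deriv

theorem contDiff_unitNormal : ContDiff ℝ ∞ (unitNormal c) :=
  contDiff_const.mul hc.contDiff_unitTangent

theorem contDiff_curvature : ContDiff ℝ ∞ (curvature c) :=
  (((contDiff_infty_iff_deriv.1 hc.contDiff_unitTangent).2).inner ℝ hc.contDiff_unitNormal).div
    hc.contDiff_norm_deriv fun t => (hc.norm_deriv_pos t).ne'

theorem norm_unitTangent (t : ℝ) : ‖unitTangent c t‖ = 1 := by
  rw [unitTangent, norm_smul, norm_inv, norm_norm, inv_mul_cancel₀ (hc.norm_deriv_pos t).ne']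

theorem unitTangent_re_sq_add_im_sq (t : ℝ) :
    (unitTangent c t).re ^ 2 + (unitTangent c t).im ^ 2 = 1 := by
  have := Complex.sq_norm (unitTangent c t)
  rw [hc.norm_unitTangent, normSq_apply] at this
  linarith

omit hc in
theorem unitNormal_re (t : ℝ) : (unitNormal c t).re = -(unitTangent c t).im := by
  simp [unitNormal]

omit hc in
theorem unitNormal_im (t : ℝ) : (unitNormal c t).im = (unitTangent c t).re := by
  simp [unitNormal]

theorem unitNormal_re_sq_add_im_sq (t : ℝ) :
    (unitNormal c t).re ^ 2 + (unitNormal c t).im ^ 2 = 1 := by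
  rw [unitNormal_re, unitNormal_im, ← hc.unitTangent_re_sq_add_im_sq t]
  ring

theorem deriv_eq_smul_unitTangent (t : ℝ) : deriv c t = ‖deriv c t‖ • unitTangent c t := by
  rw [unitTangent, smul_smul, mul_inv_cancel₀ (hc.norm_deriv_pos t).ne', one_smul]

/-- The unit tangent has constant length, so its derivative is orthogonal to it and is determined by
its normal component. -/
theorem hasDerivAt_unitTangent (t : ℝ) :
    HasDerivAt (unitTangent c) ((‖deriv c t‖ * curvature c t) • unitNormal c t) t := by
  have h := (hc.contDiff_unitTangent.differentiable (by simp) t).hasDerivAt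
  refine h.congr_deriv ?_
  have hre := reCLM.hasFDerivAt.comp_hasDerivAt t h
  have him := imCLM.hasFDerivAt.comp_hasDerivAt t h
  have hsq := (hre.mul hre).add (him.mul him)
  have hconst : (fun s => reCLM (unitTangent c s) * reCLM (unitTangent c s) +
      imCLM (unitTangent c s) * imCLM (unitTangent c s)) = fun _ => 1 := by
    funext s
    have := hc.unitTangent_re_sq_add_im_sq s
    simp only [reCLM_apply, imCLM_apply]
    linarith
  rw [show reCLM ∘ unitTangent c * reCLM ∘ unitTangent c +
    imCLM ∘ unitTangent c * imCLM ∘ unitTangent c = fun _ => 1 from hconst] at hsq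
  have horth := hsq.unique (hasDerivAt_const t (1 : ℝ))
  have h1 := hc.unitTangent_re_sq_add_im_sq t
  simp only [Function.comp_apply, reCLM_apply, imCLM_apply] at horth
  rw [curvature, mul_div_cancel₀ _ (hc.norm_deriv_pos t).ne', Complex.inner]
  generalize deriv (unitTangent c) t = d at *
  apply Complex.ext
  · simp only [unitNormal_re, unitNormal_im, real_smul, mul_re, conj_re, conj_im, ofReal_re,
      ofReal_im]
    linear_combination (-d.re) * h1 + (unitTangent c t).re / 2 * horth
  · simp only [unitNormal_re, unitNormal_im, real_smul, mul_re, mul_im, conj_re, conj_im, ofReal_re,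
      ofReal_im]
    linear_combination (-d.im) * h1 + (unitTangent c t).im / 2 * horth

theorem periodic_deriv : Function.Periodic (deriv c) ℓ := fun t => by
  rw [← deriv_comp_add_const, funext hc.periodic]

theorem periodic_unitTangent : Function.Periodic (unitTangent c) ℓ := fun t => by
  rw [unitTangent, unitTangent, hc.periodic_deriv]

theorem periodic_unitNormal : Function.Periodic (unitNormal c) ℓ := fun t => by
  rw [unitNormal, unitNormal, hc.periodic_unitTangent]

/-- Reduction modulo `ℓ` carries the injectivity on `[0, ℓ)` over to every window of one period. -/
theorem eq_of_mem_Ico {s t : ℝ} (hs : s ∈ Ico t (t + ℓ)) (h : c s = c t) : s = t := by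
  have e1 : ∀ x, c (toIcoMod hc.period_pos 0 x) = c x := fun x =>
    hc.periodic.sub_zsmul_eq (toIcoDiv hc.period_pos 0 x)
  have hmem : ∀ x, toIcoMod hc.period_pos 0 x ∈ Ico 0 ℓ := fun x => by
    simpa using toIcoMod_mem_Ico hc.period_pos 0 x
  have h1 : toIcoMod hc.period_pos 0 s = toIcoMod hc.period_pos 0 t :=
    hc.simple (hmem s) (hmem t) (by rw [e1, e1, h])
  obtain ⟨n, hn⟩ := (toIcoMod_eq_toIcoMod hc.period_pos).1 h1
  have hn' : t - s = n * ℓ := by simpa using hn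
  have hℓ := hc.period_pos
  have hlo : (n : ℝ) < 1 := by
    by_contra! hcon
    nlinarith [hs.1]
  have hhi : (-1 : ℝ) < n := by
    by_contra! hcon
    nlinarith [hs.2]
  have hn0 : n = 0 := by
    have h2 : n < 1 := by exact_mod_cast hlo
    have h3 : -1 < n := by exact_mod_cast hhi
    omega
  rw [hn0] at hn'
  simp at hn'
  linarith

theorem ne_of_mem_Ioo {s t : ℝ} (hs : s ∈ Ioo t (t + ℓ)) : c s ≠ c t := fun h =>
  hs.1.ne' (hc.eq_of_mem_Ico ⟨hs.1.le, hs.2⟩ h)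

theorem mul_meanVelocity (t h : ℝ) : (h : ℂ) * meanVelocity c t h = c (t + h) - c t := by
  rw [meanVelocity, ← intervalIntegral.integral_const_mul]
  have := intervalIntegral.integral_eq_sub_of_hasDerivAt (a := 0) (b := 1)
    (f := fun u : ℝ => c (t + u * h)) (f' := fun u => (h : ℂ) * deriv c (t + u * h))
    (fun u _ => by
      have h1 : HasDerivAt (fun u : ℝ => t + u * h) h u := by
        simpa using ((hasDerivAt_id u).mul_const h).const_add t
      simpa using! (hc.hasDerivAt (t + u * h)).scomp u h1)
    (Continuous.intervalIntegrable (by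
      have := hc.contDiff_deriv.continuous
      fun_prop) _ _)
  simpa using this

theorem sq_mul_meanAcceleration (t h : ℝ) :
    (h : ℂ) ^ 2 * meanAcceleration c t h = c (t + h) - c t - h * deriv c t := by
  rw [meanAcceleration, ← intervalIntegral.integral_const_mul]
  have := intervalIntegral.integral_eq_sub_of_hasDerivAt (a := 0) (b := 1)
    (f := fun u : ℝ => ((1 - u : ℝ) : ℂ) * (h * deriv c (t + u * h)) + c (t + u * h))
    (f' := fun u => (h : ℂ) ^ 2 * ((1 - u) • deriv (deriv c) (t + u * h)))
    (fun u _ => by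
      have h1 : HasDerivAt (fun u : ℝ => t + u * h) h u := by
        simpa using ((hasDerivAt_id u).mul_const h).const_add t
      have h2 := (hc.hasDerivAt (t + u * h)).scomp u h1
      have h3 := (hc.hasDerivAt_deriv (t + u * h)).scomp u h1
      have h4 : HasDerivAt (fun u : ℝ => ((1 - u : ℝ) : ℂ)) (-1 : ℂ) u := by
        simpa using ((hasDerivAt_id u).const_sub 1).ofReal_comp
      refine ((h4.mul (h3.const_mul (h : ℂ))).add h2).congr_deriv ?_
      simp only [Function.comp_apply, real_smul]
      ring)
    (Continuous.intervalIntegrable (by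
      have := (contDiff_infty_iff_deriv.1 hc.contDiff_deriv).2.continuous
      fun_prop) _ _)
  rw [this]
  simp
  ring

omit hc in
theorem meanVelocity_zero (t : ℝ) : meanVelocity c t 0 = deriv c t := by
  simp [meanVelocity]

theorem meanVelocity_ne_zero {t h : ℝ} (h1 : -ℓ < h) (h2 : h < ℓ) : meanVelocity c t h ≠ 0 := by
  intro h0
  have h3 := hc.mul_meanVelocity t h
  rw [h0, mul_zero] at h3
  rcases lt_trichotomy h 0 with hn | rfl | hp
  · refine hc.ne_of_mem_Ioo (s := t) (t := t + h) ⟨by linarith, by linarith⟩ ?_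
    linear_combination h3
  · rw [meanVelocity_zero] at h0
    exact hc.regular t h0
  · refine hc.ne_of_mem_Ioo (s := t + h) (t := t) ⟨by linarith, by linarith⟩ ?_
    linear_combination -h3

theorem chordCurvature_zero (t : ℝ) : chordCurvature c t 0 = curvature c t := by
  have hB : meanAcceleration c t 0 = (1 / 2 : ℝ) • deriv (deriv c) t := by
    simp only [meanAcceleration, mul_zero, add_zero]
    rw [intervalIntegral.integral_smul_const, intervalIntegral.integral_sub (by simp) (by simp)]
    norm_num
  have hv := (hc.contDiff_norm_deriv.differentiable (by simp) t).hasDerivAt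
  have h2 : deriv (deriv c) t = ‖deriv c t‖ • ((‖deriv c t‖ * curvature c t) • unitNormal c t) +
      deriv (fun t => ‖deriv c t‖) t • unitTangent c t := by
    have := hv.smul (hc.hasDerivAt_unitTangent t)
    rw [← this.deriv]
    congr 1
    exact funext hc.deriv_eq_smul_unitTangent
  have h1 := hc.unitTangent_re_sq_add_im_sq t
  have hpos := hc.norm_deriv_pos t
  have hA : (meanVelocity c t 0).re ^ 2 + (meanVelocity c t 0).im ^ 2 = ‖deriv c t‖ ^ 2 := by
    rw [meanVelocity_zero, Complex.sq_norm, normSq_apply]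
    ring
  rw [chordCurvature, hA, hB, h2, div_eq_iff (pow_pos hpos 2).ne']
  simp only [smul_re, add_re, smul_im, add_im, unitNormal_re, unitNormal_im, smul_eq_mul]
  linear_combination ‖deriv c t‖ ^ 2 * curvature c t * h1

/-- The linear Taylor term is tangential, so twice the normal component of `c (t + h) - c t` and its
squared length are `h ^ 2` times the numerator and denominator of `chordCurvature`. Having cancelled
`h ^ 2`, `chordCurvature` remains continuous at `h = 0`. -/
theorem circlineFun_eq {κ t h : ℝ} (h1 : -ℓ < h) (h2 : h < ℓ) :
    circlineFun κ (unitNormal c t) (c t) (c (t + h)) = (chordCurvature c t h - κ) *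
      ((c (t + h)).re - (c t).re) ^ 2 + (chordCurvature c t h - κ) *
      ((c (t + h)).im - (c t).im) ^ 2 := by
  have hA := hc.mul_meanVelocity t h
  have hB := hc.sq_mul_meanAcceleration t h
  have hne := re_sq_add_im_sq_ne_zero (hc.meanVelocity_ne_zero (t := t) h1 h2)
  have hv := hc.deriv_eq_smul_unitTangent t
  have hK := (div_mul_cancel₀ (2 * ((unitNormal c t).re * (meanAcceleration c t h).re +
    (unitNormal c t).im * (meanAcceleration c t h).im)) hne)
  rw [← chordCurvature] at hK
  have hAr := congrArg re hA
  have hAi := congrArg im hA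
  have hBr := congrArg re hB
  have hBi := congrArg im hB
  rw [hv] at hBr hBi
  rw [← ofReal_pow] at hBr hBi
  simp only [re_ofReal_mul, im_ofReal_mul, sub_re, sub_im, smul_re, smul_im, smul_eq_mul]
    at hAr hAi hBr hBi
  rw [circlineFun, ← hAr, ← hAi]
  rw [← hAr] at hBr
  rw [← hAi] at hBi
  rw [unitNormal_re, unitNormal_im] at *
  linear_combination (-h ^ 2) * hK + 2 * (unitTangent c t).im * hBr -
    2 * (unitTangent c t).re * hBi

theorem continuousOn_chordCurvature :
    ContinuousOn (fun p : ℝ × ℝ => chordCurvature c p.1 p.2) (univ ×ˢ Ioo (-ℓ) ℓ) := by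
  have hA : Continuous fun p : ℝ × ℝ => meanVelocity c p.1 p.2 := by
    refine intervalIntegral.continuous_parametric_intervalIntegral_of_continuous' ?_ _ _
    have := hc.contDiff_deriv.continuous
    simp only [Function.uncurry_def]
    fun_prop
  have hB : Continuous fun p : ℝ × ℝ => meanAcceleration c p.1 p.2 := by
    refine intervalIntegral.continuous_parametric_intervalIntegral_of_continuous' ?_ _ _
    have := (contDiff_infty_iff_deriv.1 hc.contDiff_deriv).2.continuous
    simp only [Function.uncurry_def]
    fun_prop
  have hN : Continuous fun p : ℝ × ℝ => unitNormal c p.1 :=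
    hc.contDiff_unitNormal.continuous.comp continuous_fst
  refine ContinuousOn.div (Continuous.continuousOn (continuous_const.mul
    (((continuous_re.comp hN).mul (continuous_re.comp hB)).add
    ((continuous_im.comp hN).mul (continuous_im.comp hB))))) (Continuous.continuousOn
    (((continuous_re.comp hA).pow 2).add ((continuous_im.comp hA).pow 2))) ?_
  rintro ⟨t, h⟩ hp
  exact re_sq_add_im_sq_ne_zero (hc.meanVelocity_ne_zero hp.2.1 hp.2.2)

end IsSimpleLoop

/-! ### Circlines as zero sets of quadratic functions. -/

section CirclineFun

variable {κ : ℝ} {n p x : ℂ}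

theorem circlineFun_self : circlineFun κ n p p = 0 := by simp [circlineFun]

theorem circlineFun_neg : circlineFun (-κ) (-n) p x = -circlineFun κ n p x := by
  simp only [circlineFun, neg_re, neg_im]
  ring

theorem continuous_circlineFun : Continuous (circlineFun κ n p) := by
  unfold circlineFun
  fun_prop

theorem circlineFun_add_smul (hn : n.re ^ 2 + n.im ^ 2 = 1) (ε : ℝ) :
    circlineFun κ n p (p + ε * n) = ε * (2 - κ * ε) := by
  simp only [circlineFun, add_re, add_im, re_ofReal_mul, im_ofReal_mul]
  linear_combination (2 * ε - κ * ε ^ 2) * hn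

theorem eventually_circlineFun_add_pos (hn : n.re ^ 2 + n.im ^ 2 = 1) :
    ∀ᶠ ε : ℝ in 𝓝[>] 0, 0 < circlineFun κ n p (p + ε * n) := by
  have h : Tendsto (fun ε : ℝ => 2 - κ * ε) (𝓝[>] 0) (𝓝 2) := by
    have : ContinuousAt (fun ε : ℝ => 2 - κ * ε) 0 := by fun_prop
    simpa using this.tendsto.mono_left (nhdsWithin_le_nhds (s := Ioi 0))
  filter_upwards [h.eventually_const_lt (show (0 : ℝ) < 2 by norm_num), self_mem_nhdsWithin]
    with ε h1 h2
  rw [circlineFun_add_smul hn]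
  exact mul_pos h2 h1

theorem eventually_circlineFun_sub_neg (hn : n.re ^ 2 + n.im ^ 2 = 1) :
    ∀ᶠ ε : ℝ in 𝓝[>] 0, circlineFun κ n p (p - ε * n) < 0 := by
  have hn' : (-n).re ^ 2 + (-n).im ^ 2 = 1 := by simpa using hn
  filter_upwards [eventually_circlineFun_add_pos (κ := -κ) (p := p) hn'] with ε hε
  rw [mul_neg, ← sub_eq_add_neg, circlineFun_neg] at hε
  linarith

/-- A circline can be described starting from any of its points. -/
theorem exists_recenter (hn : n.re ^ 2 + n.im ^ 2 = 1) (hx : circlineFun κ n p x = 0) :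
    ∃ m : ℂ, m = n - κ * (x - p) ∧ m.re ^ 2 + m.im ^ 2 = 1 ∧
      ∀ y, circlineFun κ m x y = circlineFun κ n p y := by
  refine ⟨n - κ * (x - p), rfl, ?_, fun y => ?_⟩
  · simp only [circlineFun, sub_re, sub_im, re_ofReal_mul, im_ofReal_mul] at *
    linear_combination hn - κ * hx
  · simp only [circlineFun, sub_re, sub_im, re_ofReal_mul, im_ofReal_mul] at *
    linear_combination -hx

/-- Recenter the circline at `x` and approach `x` along the unit normal there. -/
theorem mem_closure_circlineFun_pos (hn : n.re ^ 2 + n.im ^ 2 = 1)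
    (hx : circlineFun κ n p x = 0) : x ∈ closure {y | 0 < circlineFun κ n p y} := by
  obtain ⟨m, -, hm, hy⟩ := exists_recenter hn hx
  have ht : Tendsto (fun ε : ℝ => x + ε * m) (𝓝[>] 0) (𝓝 x) := by
    have : ContinuousAt (fun ε : ℝ => x + ε * m) 0 := by fun_prop
    simpa using this.tendsto.mono_left (nhdsWithin_le_nhds (s := Ioi 0))
  refine mem_closure_of_tendsto ht ?_
  filter_upwards [eventually_circlineFun_add_pos (κ := κ) (p := x) hm] with ε hε
  rwa [hy] at hε

theorem isPreconnected_compl_closedBall (z : ℂ) {r : ℝ} (hr : 0 ≤ r) :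
    IsPreconnected {x : ℂ | r < ‖x - z‖} := by
  have h : IsPreconnected ((fun q : ℝ × ℝ => z + q.1 * exp (q.2 * I)) '' (Ioi r ×ˢ univ)) :=
    (isPreconnected_Ioi.prod isPreconnected_univ).image _ (by fun_prop)
  convert! h using 1
  ext x
  constructor
  · intro hx
    exact ⟨(‖x - z‖, (x - z).arg), ⟨hx, trivial⟩, by
      change z + (‖x - z‖ : ℝ) * exp ((x - z).arg * I) = x
      rw [norm_mul_exp_arg_mul_I, add_sub_cancel]⟩
  · rintro ⟨⟨ρ, θ⟩, ⟨h1, -⟩, rfl⟩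
    have h1' : r < ρ := h1
    simpa [abs_of_pos (hr.trans_lt h1')] using h1'

theorem circlineFun_eq_of_ne_zero (hn : n.re ^ 2 + n.im ^ 2 = 1) (hκ : κ ≠ 0) :
    circlineFun κ n p x = κ * ((κ⁻¹) ^ 2 - ‖x - (p + (κ⁻¹ : ℝ) * n)‖ ^ 2) := by
  rw [Complex.sq_norm, normSq_apply]
  simp only [circlineFun, sub_re, sub_im, add_re, add_im, re_ofReal_mul, im_ofReal_mul]
  field_simp
  linear_combination hn

/-- The set is the exterior of a circle, an open half-plane or an open disk according to the sign of
`κ`. -/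
theorem isPreconnected_circlineFun_pos (hn : n.re ^ 2 + n.im ^ 2 = 1) :
    IsPreconnected {x | 0 < circlineFun κ n p x} := by
  rcases lt_trichotomy κ 0 with hκ | rfl | hκ
  · convert! isPreconnected_compl_closedBall (p + (κ⁻¹ : ℝ) * n) (abs_nonneg κ⁻¹) using 1
    ext x
    rw [mem_ofPred_eq, mem_ofPred_eq, circlineFun_eq_of_ne_zero hn hκ.ne, ← neg_mul_neg,
      mul_pos_iff_of_pos_left (neg_pos.2 hκ), neg_sub, sub_pos, ← sq_abs κ⁻¹]
    exact pow_lt_pow_iff_left₀ (abs_nonneg _) (norm_nonneg _) two_ne_zero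
  · refine Convex.isPreconnected ?_
    have hlin : IsLinearMap ℝ fun x : ℂ => n.re * x.re + n.im * x.im :=
      ⟨fun x y => by simp only [add_re, add_im]; ring,
        fun a x => by simp only [smul_re, smul_im, smul_eq_mul]; ring⟩
    convert! (convex_Ioi (n.re * p.re + n.im * p.im)).is_linear_preimage hlin using 1
    ext x
    simp only [circlineFun, mem_ofPred_eq, mem_preimage, mem_Ioi]
    constructor <;> intro h <;> linarith
  · convert! (convex_ball (p + (κ⁻¹ : ℝ) * n) κ⁻¹).isPreconnected using 1
    ext x
    rw [mem_ofPred_eq, Metric.mem_ball, dist_eq_norm, circlineFun_eq_of_ne_zero hn hκ.ne',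
      mul_pos_iff_of_pos_left hκ, sub_pos]
    exact pow_lt_pow_iff_left₀ (norm_nonneg _) (inv_pos.2 hκ).le two_ne_zero

end CirclineFun

/-- The tangent circline of curvature `maxCurvature c ℓ t` at `t` passes through `c s`. -/
def Touches (c : ℝ → ℂ) (ℓ t s : ℝ) : Prop :=
  circlineFun (maxCurvature c ℓ t) (unitNormal c t) (c t) (c s) = 0

/-! ### Third-order contact. -/

section Vertex

variable {f g w v₁ v₂ : ℝ → ℝ} {t d : ℝ}

/-- If `d` were positive, then `w`, hence `g`, hence `f` would be positive just after `t`. The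
positive factors `v₁`, `v₂` stand for the speed, so no arc-length parameter is needed. -/
theorem thirdDeriv_nonpos (hf : ∀ s, HasDerivAt f (v₁ s * g s) s)
    (hg : ∀ s, HasDerivAt g (v₂ s * w s) s) (hv₁ : ∀ s, 0 < v₁ s) (hv₂ : ∀ s, 0 < v₂ s)
    (hw : HasDerivAt w d t) (hft : f t = 0) (hgt : g t = 0) (hwt : w t = 0)
    (hle : ∀ s, f s ≤ 0) : d ≤ 0 := by
  by_contra! hd
  obtain ⟨δ, hδ, hball⟩ := Metric.eventually_nhds_iff.1
    (eventually_nhdsWithin_sign_eq_of_deriv_pos (f := w) (by rwa [hw.deriv]) hwt)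
  have hwpos : ∀ s ∈ Ioo t (t + δ), 0 < w s := by
    intro s hs
    have := hball (y := s) (by rw [Real.dist_eq, abs_lt]; constructor <;> linarith [hs.1, hs.2])
    rw [sign_pos (sub_pos.2 hs.1)] at this
    exact sign_eq_one_iff.1 this
  have hmono : ∀ {F F' : ℝ → ℝ}, (∀ s, HasDerivAt F (F' s) s) → (∀ s ∈ Ioo t (t + δ), 0 < F' s) →
      ∀ s ∈ Ioo t (t + δ), F t < F s := by
    intro F F' hF hF' s hs
    refine strictMonoOn_of_deriv_pos (convex_Icc t s)
      (fun x _ => (hF x).continuousAt.continuousWithinAt) (fun x hx => ?_)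
      (left_mem_Icc.2 hs.1.le) (right_mem_Icc.2 hs.1.le) hs.1
    rw [interior_Icc] at hx
    rw [(hF x).deriv]
    exact hF' x ⟨hx.1, hx.2.trans hs.2⟩
  have hgpos : ∀ s ∈ Ioo t (t + δ), 0 < g s := fun s hs =>
    hgt ▸ hmono hg (fun s hs => mul_pos (hv₂ s) (hwpos s hs)) s hs
  have hfpos := hmono hf (fun s hs => mul_pos (hv₁ s) (hgpos s hs)) (t + δ / 2)
    ⟨by linarith, by linarith⟩
  rw [hft] at hfpos
  exact (hle _).not_gt hfpos

theorem thirdDeriv_eq_zero (hf : ∀ s, HasDerivAt f (v₁ s * g s) s)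
    (hg : ∀ s, HasDerivAt g (v₂ s * w s) s) (hv₁ : ∀ s, 0 < v₁ s) (hv₂ : ∀ s, 0 < v₂ s)
    (hw : HasDerivAt w d t) (hft : f t = 0) (hgt : g t = 0) (hwt : w t = 0)
    (hle : ∀ s, f s ≤ 0) : d = 0 := by
  refine le_antisymm (thirdDeriv_nonpos hf hg hv₁ hv₂ hw hft hgt hwt hle) (neg_nonpos.1 ?_)
  -- Time reversal keeps `f` and `w` and changes the signs of `g` and `d`.
  have hneg : ∀ s : ℝ, HasDerivAt (fun s : ℝ => -s) (-1) s := fun s => (hasDerivAt_id s).neg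
  refine thirdDeriv_nonpos (f := fun s => f (-s)) (g := fun s => -g (-s)) (w := fun s => w (-s))
    (v₁ := fun s => v₁ (-s)) (v₂ := fun s => v₂ (-s)) (t := -t) (fun s => ?_) (fun s => ?_)
    (fun s => hv₁ _) (fun s => hv₂ _) ?_ (by simpa) (by simpa) (by simpa) fun s => hle _
  · refine ((hf (-s)).comp s (hneg s)).congr_deriv (by ring)
  · refine ((hg (-s)).comp s (hneg s)).neg.congr_deriv (by ring)
  · have hw' : HasDerivAt w d (- -t) := by rwa [neg_neg]
    refine (hw'.comp (-t) (hneg (-t))).congr_deriv (by ring)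

end Vertex

/-! ### The largest supporting circline at each point, and vertices. -/

namespace IsSimpleLoop

variable {c : ℝ → ℂ} {ℓ : ℝ} (hc : IsSimpleLoop c ℓ)
include hc

/-- Clamping `h` to half a period covers the whole curve, avoids `h = ±ℓ`, where the denominator
vanishes, and gives continuity on all of `ℝ × ℝ`, as needed for the supremum to depend continuously
on `t`. -/
theorem continuous_chordCurvature_clamp : Continuous fun p : ℝ × ℝ =>
    chordCurvature c p.1 (max (-(ℓ / 2)) (min (ℓ / 2) p.2)) := by
  have hℓ := hc.period_pos
  refine hc.continuousOn_chordCurvature.comp_continuous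
    (f := fun p : ℝ × ℝ => (p.1, max (-(ℓ / 2)) (min (ℓ / 2) p.2))) (by fun_prop) fun p => ?_
  refine ⟨trivial, lt_max_of_lt_left (by linarith), max_lt (by linarith) (min_lt_of_left_lt ?_)⟩
  linarith

theorem continuous_chordCurvature_clamp_right (t : ℝ) :
    Continuous fun h => chordCurvature c t (max (-(ℓ / 2)) (min (ℓ / 2) h)) :=
  Continuous.comp (f := fun h : ℝ => (t, h)) hc.continuous_chordCurvature_clamp (by fun_prop)

theorem continuous_maxCurvature : Continuous (maxCurvature c ℓ) :=
  isCompact_Icc.continuous_sSup hc.continuous_chordCurvature_clamp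

omit hc in
theorem clamp_eq {h : ℝ} (hh : h ∈ Icc (-(ℓ / 2)) (ℓ / 2)) :
    max (-(ℓ / 2)) (min (ℓ / 2) h) = h := by
  rw [min_eq_right hh.2, max_eq_right hh.1]

theorem chordCurvature_le_maxCurvature (t : ℝ) {h : ℝ} (hh : h ∈ Icc (-(ℓ / 2)) (ℓ / 2)) :
    chordCurvature c t h ≤ maxCurvature c ℓ t := by
  have hmem := mem_image_of_mem
    (fun h => chordCurvature c t (max (-(ℓ / 2)) (min (ℓ / 2) h))) hh
  rw [clamp_eq hh] at hmem
  exact le_csSup (isCompact_Icc.image (hc.continuous_chordCurvature_clamp_right t)).bddAbove hmem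

theorem exists_chordCurvature_eq_maxCurvature (t : ℝ) :
    ∃ h ∈ Icc (-(ℓ / 2)) (ℓ / 2), chordCurvature c t h = maxCurvature c ℓ t := by
  have hℓ := hc.period_pos
  have hne : (Icc (-(ℓ / 2)) (ℓ / 2)).Nonempty := nonempty_Icc.2 (by linarith)
  obtain ⟨h, hh, he⟩ :=
    (isCompact_Icc.image (hc.continuous_chordCurvature_clamp_right t)).sSup_mem (hne.image _)
  beta_reduce at he
  rw [clamp_eq hh] at he
  exact ⟨h, hh, he⟩

theorem curvature_le_maxCurvature (t : ℝ) : curvature c t ≤ maxCurvature c ℓ t := by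
  have hℓ := hc.period_pos
  rw [← hc.chordCurvature_zero]
  exact hc.chordCurvature_le_maxCurvature t ⟨by linarith, by linarith⟩

theorem exists_eq_add (t s : ℝ) : ∃ h ∈ Ico (-(ℓ / 2)) (ℓ / 2), c s = c (t + h) := by
  obtain ⟨y, hy, he⟩ := hc.periodic.exists_mem_Ico hc.period_pos s (t - ℓ / 2)
  exact ⟨y - t, ⟨by linarith [hy.1], by linarith [hy.2]⟩, by rw [he, add_sub_cancel]⟩

theorem circlineFun_nonpos_iff {κ t h : ℝ} (h1 : -ℓ < h) (h2 : h < ℓ) (h0 : h ≠ 0) :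
    circlineFun κ (unitNormal c t) (c t) (c (t + h)) ≤ 0 ↔ chordCurvature c t h ≤ κ := by
  have hne : c (t + h) - c t ≠ 0 := by
    rw [← hc.mul_meanVelocity]
    exact mul_ne_zero (by exact_mod_cast h0) (hc.meanVelocity_ne_zero h1 h2)
  have := normSq_pos.2 hne
  rw [normSq_apply, sub_re, sub_im] at this
  rw [hc.circlineFun_eq h1 h2, ← mul_add, ← sub_nonpos (b := κ)]
  constructor
  · intro h
    by_contra! hcon
    nlinarith
  · intro h
    exact mul_nonpos_of_nonpos_of_nonneg h (by positivity)

theorem touches_add_iff {t h : ℝ} (h1 : -ℓ < h) (h2 : h < ℓ) (h0 : h ≠ 0) :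
    Touches c ℓ t (t + h) ↔ chordCurvature c t h = maxCurvature c ℓ t := by
  have hne : c (t + h) - c t ≠ 0 := by
    rw [← hc.mul_meanVelocity]
    exact mul_ne_zero (by exact_mod_cast h0) (hc.meanVelocity_ne_zero h1 h2)
  have := re_sq_add_im_sq_ne_zero hne
  rw [sub_re, sub_im] at this
  rw [Touches, hc.circlineFun_eq h1 h2, ← mul_add, mul_eq_zero, or_iff_left this, sub_eq_zero]

theorem circlineFun_maxCurvature_nonpos (t s : ℝ) :
    circlineFun (maxCurvature c ℓ t) (unitNormal c t) (c t) (c s) ≤ 0 := by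
  have hℓ := hc.period_pos
  obtain ⟨h, hh, he⟩ := hc.exists_eq_add t s
  rw [he]
  rcases eq_or_ne h 0 with rfl | h0
  · rw [add_zero, circlineFun_self]
  · rw [hc.circlineFun_nonpos_iff (by linarith [hh.1]) (by linarith [hh.2]) h0]
    exact hc.chordCurvature_le_maxCurvature t ⟨hh.1, hh.2.le⟩

theorem touches_add_period {t s : ℝ} : Touches c ℓ t (s + ℓ) ↔ Touches c ℓ t s := by
  rw [Touches, Touches, hc.periodic]

theorem maxCurvature_eq_or_exists_touches (t : ℝ) :
    maxCurvature c ℓ t = curvature c t ∨ ∃ s ∈ Ioo t (t + ℓ), Touches c ℓ t s := by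
  have hℓ := hc.period_pos
  obtain ⟨h, hh, he⟩ := hc.exists_chordCurvature_eq_maxCurvature t
  rcases lt_trichotomy h 0 with h0 | rfl | h0
  · refine Or.inr ⟨t + h + ℓ, ⟨by linarith [hh.1], by linarith⟩, ?_⟩
    rw [hc.touches_add_period, hc.touches_add_iff (by linarith [hh.1]) (by linarith) h0.ne]
    exact he
  · rw [hc.chordCurvature_zero] at he
    exact Or.inl he.symm
  · refine Or.inr ⟨t + h, ⟨by linarith, by linarith [hh.2]⟩, ?_⟩
    rw [hc.touches_add_iff (by linarith) (by linarith [hh.2]) h0.ne']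
    exact he

theorem continuousAt_chordCurvature {t h : ℝ} (h1 : -ℓ < h) (h2 : h < ℓ) :
    ContinuousAt (chordCurvature c t) h :=
  ContinuousAt.comp (g := fun p : ℝ × ℝ => chordCurvature c p.1 p.2) (f := fun h => (t, h))
    (hc.continuousOn_chordCurvature.continuousAt
      ((isOpen_univ.prod isOpen_Ioo).mem_nhds ⟨trivial, h1, h2⟩)) (by fun_prop)

theorem maxCurvature_le {κ t : ℝ}
    (h : ∀ s, circlineFun κ (unitNormal c t) (c t) (c s) ≤ 0) : maxCurvature c ℓ t ≤ κ := by
  have hℓ := hc.period_pos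
  have hne : ∀ h', h' ∈ Ioo (-ℓ) ℓ → h' ≠ 0 → chordCurvature c t h' ≤ κ := fun h' hh h0 =>
    (hc.circlineFun_nonpos_iff hh.1 hh.2 h0).1 (h _)
  obtain ⟨h', hh, he⟩ := hc.exists_chordCurvature_eq_maxCurvature t
  rw [← he]
  rcases eq_or_ne h' 0 with rfl | h0
  -- At `h = 0` the circline gives no condition; the bound is the limit of those for `h > 0`.
  · have hcont := (hc.continuousAt_chordCurvature (t := t) (h := 0) (by linarith) hℓ).tendsto.mono_left
      (nhdsWithin_le_nhds (s := Ioi 0))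
    refine le_of_tendsto hcont ?_
    filter_upwards [Ioo_mem_nhdsGT hℓ] with x hx
    exact hne x ⟨by linarith [hx.1], hx.2⟩ hx.1.ne'
  · exact hne h' ⟨by linarith [hh.1], by linarith [hh.2]⟩ h0

/-- Chord curvature is bounded by compactness and periodicity. The bound says that the two open
disks of radius `1 / B` tangent to the curve at any of its points miss the curve. -/
theorem exists_chord_bound : ∃ B > 0, ∀ t s,
    |2 * ((unitNormal c t).re * ((c s).re - (c t).re) + (unitNormal c t).im * ((c s).im - (c t).im))|
      ≤ B * (((c s).re - (c t).re) ^ 2 + ((c s).im - (c t).im) ^ 2) := by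
  have hℓ := hc.period_pos
  obtain ⟨B, hB⟩ := (isCompact_Icc.prod isCompact_Icc : IsCompact
    (Icc (0 : ℝ) ℓ ×ˢ Icc (-(ℓ / 2)) (ℓ / 2))).exists_bound_of_continuousOn
    hc.continuous_chordCurvature_clamp.continuousOn
  refine ⟨max B 1, by positivity, fun t s => ?_⟩
  obtain ⟨t', ht', h1⟩ : ∃ t' ∈ Ico 0 ℓ, (c t, unitNormal c t) = (c t', unitNormal c t') := by
    have hper : Function.Periodic (fun t => (c t, unitNormal c t)) ℓ := fun t => by
      simp only [hc.periodic t, hc.periodic_unitNormal t]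
    simpa using hper.exists_mem_Ico hℓ t 0
  obtain ⟨e1, e2⟩ := Prod.mk.inj h1
  rw [e1, e2]
  obtain ⟨h, hh, he⟩ := hc.exists_eq_add t' s
  have hbd := hB (t', h) ⟨⟨ht'.1, ht'.2.le⟩, hh.1, hh.2.le⟩
  simp only [clamp_eq ⟨hh.1, hh.2.le⟩] at hbd
  have h0 := hc.circlineFun_eq (κ := 0) (t := t') (h := h) (by linarith [hh.1]) (by linarith [hh.2])
  rw [← he, circlineFun, zero_mul, sub_zero, sub_zero, ← mul_add] at h0
  rw [h0, abs_mul, abs_of_nonneg (a := ((c s).re - (c t').re) ^ 2 + _) (by positivity)]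
  exact mul_le_mul_of_nonneg_right (hbd.trans (le_max_left _ _)) (by positivity)

/-- A curve that is supported at `t` by its osculating circline has a vertex at `t`. -/
theorem hasDerivAt_curvature_zero {t : ℝ}
    (h : ∀ s, circlineFun (curvature c t) (unitNormal c t) (c t) (c s) ≤ 0) :
    HasDerivAt (curvature c) 0 t := by
  have hk := (hc.contDiff_curvature.differentiable (by simp) t).hasDerivAt
  have hre : ∀ {f : ℝ → ℂ} {f' : ℂ} {s : ℝ}, HasDerivAt f f' s →
      HasDerivAt (fun s => (f s).re) f'.re s := fun hf => reCLM.hasFDerivAt.comp_hasDerivAt _ hf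
  have him : ∀ {f : ℝ → ℂ} {f' : ℂ} {s : ℝ}, HasDerivAt f f' s →
      HasDerivAt (fun s => (f s).im) f'.im s := fun hf => imCLM.hasFDerivAt.comp_hasDerivAt _ hf
  have hcr := fun s => (hre (hc.hasDerivAt s)).sub_const (c t).re
  have hci := fun s => (him (hc.hasDerivAt s)).sub_const (c t).im
  have hTr := fun s => hre (hc.hasDerivAt_unitTangent s)
  have hTi := fun s => him (hc.hasDerivAt_unitTangent s)
  obtain ⟨n, hn⟩ : ∃ n, n = unitNormal c t := ⟨_, rfl⟩
  obtain ⟨k, hkk⟩ : ∃ k, k = curvature c t := ⟨_, rfl⟩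
  rw [← hn, ← hkk] at h
  have hnr : n.re = -(unitTangent c t).im := by rw [hn, unitNormal_re]
  have hni : n.im = (unitTangent c t).re := by rw [hn, unitNormal_im]
  have hMr := fun s => ((hcr s).const_mul k).const_sub n.re
  have hMi := fun s => ((hci s).const_mul k).const_sub n.im
  have hvr : ∀ s, (deriv c s).re = ‖deriv c s‖ * (unitTangent c s).re := fun s => by
    rw [← smul_eq_mul, ← smul_re, ← hc.deriv_eq_smul_unitTangent]
  have hvi : ∀ s, (deriv c s).im = ‖deriv c s‖ * (unitTangent c s).im := fun s => by
    rw [← smul_eq_mul, ← smul_im, ← hc.deriv_eq_smul_unitTangent]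
  have hd : deriv (curvature c) t = 0 := by
    -- With `M = n - k (c s - c t)`, `f` has derivative `2 ‖c'‖ (T · M)`, and `g = T · M` has
    -- derivative `‖c'‖ (curvature * (N · M) - k)`. At `t`, `M = N`, so `w` vanishes there and its
    -- derivative is that of the curvature.
    refine thirdDeriv_eq_zero (t := t)
      (f := fun s => circlineFun k n (c t) (c s))
      (g := fun s => (unitTangent c s).re * (n.re - k * ((c s).re - (c t).re)) +
        (unitTangent c s).im * (n.im - k * ((c s).im - (c t).im)))
      (w := fun s => curvature c s * (-(unitTangent c s).im * (n.re - k * ((c s).re - (c t).re)) +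
        (unitTangent c s).re * (n.im - k * ((c s).im - (c t).im))) - k)
      (v₁ := fun s => 2 * ‖deriv c s‖) (v₂ := fun s => ‖deriv c s‖)
      (fun s => ?_) (fun s => ?_) (fun s => ?_) hc.norm_deriv_pos ?_ circlineFun_self ?_ ?_ h
    · refine ((((hcr s).const_mul n.re).add ((hci s).const_mul n.im)).const_mul 2 |>.sub
        ((((hcr s).pow 2).add ((hci s).pow 2)).const_mul k)).congr_deriv ?_
      rw [hvr, hvi]
      norm_num
      ring
    · refine (((hTr s).mul (hMr s)).add ((hTi s).mul (hMi s))).congr_deriv ?_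
      rw [hvr, hvi]
      simp only [smul_re, smul_im, smul_eq_mul, unitNormal_re, unitNormal_im]
      linear_combination (-k * ‖deriv c s‖) * hc.unitTangent_re_sq_add_im_sq s
    · have := hc.norm_deriv_pos s
      positivity
    · refine ((hk.mul (((hTi t).neg.mul (hMr t)).add ((hTr t).mul (hMi t)))).sub_const k).congr_deriv ?_
      rw [hvr, hvi]
      simp only [smul_re, smul_im, smul_eq_mul, unitNormal_re, unitNormal_im, hnr, hni, Pi.add_apply,
        Pi.mul_apply, Pi.neg_apply]
      linear_combination deriv (curvature c) t * hc.unitTangent_re_sq_add_im_sq t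
    · rw [hnr, hni]
      ring
    · rw [hnr, hni, hkk]
      linear_combination curvature c t * hc.unitTangent_re_sq_add_im_sq t
  rw [hd] at hk
  exact hk

end IsSimpleLoop

/-! ### The two sides of the curve. -/

theorem eq_of_hasDerivAt_zero {f : ℂ → ℂ} {U T : Set ℂ} (hU : IsOpen U)
    (hf : ∀ x ∈ U, HasDerivAt f 0 x) (hT : IsPreconnected T) (hTU : T ⊆ U) {x y : ℂ}
    (hx : x ∈ T) (hy : y ∈ T) : f x = f y := by
  have hsub := hT.subset_connectedComponentIn hx hTU
  have hcU := connectedComponentIn_subset U x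
  exact (hU.connectedComponentIn (x := x)).is_const_of_deriv_eq_zero
    isPreconnected_connectedComponentIn
    (fun z hz => (hf z (hcU hz)).differentiableAt.differentiableWithinAt)
    (fun z hz => (hf z (hcU hz)).deriv) (hsub hx) (hsub hy)

/-- The points that can be joined in the complement of the curve to points near `c 0` on the left
of the curve. -/
def leftSide (c : ℝ → ℂ) : Set ℂ :=
  {x | x ∈ (range c)ᶜ ∧
    ∀ᶠ ε : ℝ in 𝓝[>] 0, c 0 + ε * unitNormal c 0 ∈ connectedComponentIn (range c)ᶜ x}

/-- The points that can be joined in the complement of the curve to points near `c 0` on the right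
of the curve. -/
def rightSide (c : ℝ → ℂ) : Set ℂ :=
  {x | x ∈ (range c)ᶜ ∧
    ∀ᶠ ε : ℝ in 𝓝[>] 0, c 0 - ε * unitNormal c 0 ∈ connectedComponentIn (range c)ᶜ x}

theorem eq_connectedComponentIn_of_mem_side {S : Set ℂ} {f : ℝ → ℂ} {x : ℂ}
    (hx : x ∈ {x | x ∈ S ∧ ∀ᶠ ε : ℝ in 𝓝[>] 0, f ε ∈ connectedComponentIn S x}) :
    {x | x ∈ S ∧ ∀ᶠ ε : ℝ in 𝓝[>] 0, f ε ∈ connectedComponentIn S x} =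
      connectedComponentIn S x := by
  ext y
  constructor
  · rintro ⟨hyS, hy⟩
    obtain ⟨ε, h1, h2⟩ := (hy.and hx.2).exists
    rw [connectedComponentIn_eq h2, ← connectedComponentIn_eq h1]
    exact mem_connectedComponentIn hyS
  · intro hy
    refine ⟨connectedComponentIn_subset S x hy, ?_⟩
    rw [← connectedComponentIn_eq hy]
    exact hx.2

theorem leftSide_eq {c : ℝ → ℂ} {x : ℂ} (hx : x ∈ leftSide c) :
    leftSide c = connectedComponentIn (range c)ᶜ x :=
  eq_connectedComponentIn_of_mem_side hx

theorem rightSide_eq {c : ℝ → ℂ} {x : ℂ} (hx : x ∈ rightSide c) :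
    rightSide c = connectedComponentIn (range c)ᶜ x :=
  eq_connectedComponentIn_of_mem_side hx

theorem leftSide_subset (c : ℝ → ℂ) : leftSide c ⊆ (range c)ᶜ := fun _ hx => hx.1

theorem rightSide_subset (c : ℝ → ℂ) : rightSide c ⊆ (range c)ᶜ := fun _ hx => hx.1

theorem subset_leftSide {c : ℝ → ℂ} {T : Set ℂ} (hT : IsPreconnected T) (hTS : T ⊆ (range c)ᶜ)
    {x : ℂ} (hx : x ∈ T) (hxl : x ∈ leftSide c) : T ⊆ leftSide c := by
  rw [leftSide_eq hxl]
  exact hT.subset_connectedComponentIn hx hTS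

theorem subset_rightSide {c : ℝ → ℂ} {T : Set ℂ} (hT : IsPreconnected T) (hTS : T ⊆ (range c)ᶜ)
    {x : ℂ} (hx : x ∈ T) (hxl : x ∈ rightSide c) : T ⊆ rightSide c := by
  rw [rightSide_eq hxl]
  exact hT.subset_connectedComponentIn hx hTS

namespace IsSimpleLoop

variable {c : ℝ → ℂ} {ℓ : ℝ} (hc : IsSimpleLoop c ℓ)
include hc

theorem isCompact_range : IsCompact (range c) := by
  have : range c = c '' Icc 0 ℓ := by
    refine Subset.antisymm ?_ (image_subset_range _ _)
    rintro _ ⟨t, rfl⟩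
    obtain ⟨y, hy, he⟩ := hc.periodic.exists_mem_Ico hc.period_pos t 0
    rw [zero_add] at hy
    exact ⟨y, Ico_subset_Icc_self hy, he.symm⟩
  rw [this]
  exact isCompact_Icc.image hc.continuous

theorem isOpen_compl_range : IsOpen (range c)ᶜ := hc.isCompact_range.isClosed.isOpen_compl

theorem exists_collar : ∃ r > 0, ∀ (t ε : ℝ), ε ≠ 0 → |ε| < r →
    c t + ε * unitNormal c t ∈ (range c)ᶜ := by
  obtain ⟨B, hB, h⟩ := hc.exists_chord_bound
  -- A point of the curve at signed distance `ε` along the normal would give `2 |ε| ≤ B ε ^ 2`.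
  refine ⟨2 / B, by positivity, fun t ε hε hεr => ?_⟩
  rintro ⟨s, hs⟩
  have hbd := h t s
  have hn := hc.unitNormal_re_sq_add_im_sq t
  have hr : (c s).re - (c t).re = ε * (unitNormal c t).re := by
    rw [hs, add_re, re_ofReal_mul]
    ring
  have hi : (c s).im - (c t).im = ε * (unitNormal c t).im := by
    rw [hs, add_im, im_ofReal_mul]
    ring
  rw [hr, hi] at hbd
  rw [show 2 * ((unitNormal c t).re * (ε * (unitNormal c t).re) +
    (unitNormal c t).im * (ε * (unitNormal c t).im)) = 2 * ε by linear_combination (2 * ε) * hn,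
    show (ε * (unitNormal c t).re) ^ 2 + (ε * (unitNormal c t).im) ^ 2 = |ε| ^ 2 by
      rw [sq_abs]
      linear_combination ε ^ 2 * hn, abs_mul, abs_two] at hbd
  rw [lt_div_iff₀ hB] at hεr
  have := abs_pos.2 hε
  nlinarith

/-- A one-sided strip along the curve is the continuous image of a product of intervals. Hence the
sides, defined by the points near `c 0`, can be recognized near any `c t`. -/
theorem exists_isPreconnected_collar : ∃ r > 0,
    (∃ L, IsPreconnected L ∧ L ⊆ (range c)ᶜ ∧
      ∀ t, ∀ ε : ℝ, 0 < ε → ε < r → c t + ε * unitNormal c t ∈ L) ∧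
    ∃ R, IsPreconnected R ∧ R ⊆ (range c)ᶜ ∧
      ∀ t, ∀ ε : ℝ, 0 < ε → ε < r → c t - ε * unitNormal c t ∈ R := by
  obtain ⟨r, hr, h⟩ := hc.exists_collar
  have hcont := hc.continuous
  have hN := hc.contDiff_unitNormal.continuous
  have h1 : Continuous fun p : ℝ × ℝ => unitNormal c p.1 := hN.comp continuous_fst
  have h2 : Continuous fun p : ℝ × ℝ => c p.1 := hcont.comp continuous_fst
  have h3 : Continuous fun p : ℝ × ℝ => (p.2 : ℂ) := by fun_prop
  have hprod : IsPreconnected ((univ : Set ℝ) ×ˢ Ioo 0 r) :=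
    isPreconnected_univ.prod isPreconnected_Ioo
  refine ⟨r, hr, ⟨_, hprod.image (fun p : ℝ × ℝ => c p.1 + p.2 * unitNormal c p.1)
      (h2.add (h3.mul h1)).continuousOn, ?_, fun t ε h0 hε => ⟨(t, ε), ⟨trivial, h0, hε⟩, rfl⟩⟩,
    ⟨_, hprod.image (fun p : ℝ × ℝ => c p.1 - p.2 * unitNormal c p.1)
      (h2.sub (h3.mul h1)).continuousOn, ?_, fun t ε h0 hε => ⟨(t, ε), ⟨trivial, h0, hε⟩, rfl⟩⟩⟩
  · rintro _ ⟨⟨t, ε⟩, ⟨-, hε⟩, rfl⟩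
    exact h t ε hε.1.ne' (by rw [abs_of_pos hε.1]; exact hε.2)
  · rintro _ ⟨⟨t, ε⟩, ⟨-, hε⟩, rfl⟩
    have := h t (-ε) (neg_ne_zero.2 hε.1.ne') (by rw [abs_neg, abs_of_pos hε.1]; exact hε.2)
    rwa [ofReal_neg, neg_mul, ← sub_eq_add_neg] at this

theorem exists_mem_sides : ∃ r > 0, ∀ t, ∀ ε : ℝ, 0 < ε → ε < r →
    c t + ε * unitNormal c t ∈ leftSide c ∧ c t - ε * unitNormal c t ∈ rightSide c := by
  obtain ⟨r, hr, ⟨L, hL, hLS, hLm⟩, R, hR, hRS, hRm⟩ := hc.exists_isPreconnected_collar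
  refine ⟨r, hr, fun t ε h0 hε => ⟨⟨hLS (hLm t ε h0 hε), ?_⟩, hRS (hRm t ε h0 hε), ?_⟩⟩
  · filter_upwards [Ioo_mem_nhdsGT hr] with δ hδ
    exact hL.subset_connectedComponentIn (hLm t ε h0 hε) hLS (hLm 0 δ hδ.1 hδ.2)
  · filter_upwards [Ioo_mem_nhdsGT hr] with δ hδ
    exact hR.subset_connectedComponentIn (hRm t ε h0 hε) hRS (hRm 0 δ hδ.1 hδ.2)

theorem eventually_mem_leftSide (t : ℝ) :
    ∀ᶠ ε : ℝ in 𝓝[>] 0, c t + ε * unitNormal c t ∈ leftSide c := by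
  obtain ⟨r, hr, h⟩ := hc.exists_mem_sides
  filter_upwards [Ioo_mem_nhdsGT hr] with ε hε
  exact (h t ε hε.1 hε.2).1

theorem eventually_mem_rightSide (t : ℝ) :
    ∀ᶠ ε : ℝ in 𝓝[>] 0, c t - ε * unitNormal c t ∈ rightSide c := by
  obtain ⟨r, hr, h⟩ := hc.exists_mem_sides
  filter_upwards [Ioo_mem_nhdsGT hr] with ε hε
  exact (h t ε hε.1 hε.2).2

theorem isPreconnected_leftSide : IsPreconnected (leftSide c) := by
  obtain ⟨ε, hε⟩ := (hc.eventually_mem_leftSide 0).exists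
  rw [leftSide_eq hε]
  exact isPreconnected_connectedComponentIn

theorem isPreconnected_rightSide : IsPreconnected (rightSide c) := by
  obtain ⟨ε, hε⟩ := (hc.eventually_mem_rightSide 0).exists
  rw [rightSide_eq hε]
  exact isPreconnected_connectedComponentIn

theorem hasDerivAt_cauchyIntegral_period {x : ℂ} (hx : x ∈ (range c)ᶜ) :
    HasDerivAt (cauchyIntegral c (-(ℓ / 2)) (ℓ / 2)) 0 x := by
  refine (hasDerivAt_cauchyIntegral hc.contDiff_one fun h => hx (image_subset_range _ _ h)).congr_deriv ?_
  rw [← hc.periodic (-(ℓ / 2)), show -(ℓ / 2) + ℓ = ℓ / 2 by ring, sub_self]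

omit hc in
theorem deriv_div_normal_re (hc : IsSimpleLoop c ℓ) (t : ℝ) :
    unitTangent c t ≠ 0 ∧ 0 < (deriv c t / unitTangent c t).re := by
  have h0 : unitTangent c t ≠ 0 := norm_ne_zero_iff.1 (by rw [hc.norm_unitTangent]; exact one_ne_zero)
  refine ⟨h0, ?_⟩
  have : deriv c t / unitTangent c t = (‖deriv c t‖ : ℂ) := by
    rw [div_eq_iff h0, ← real_smul, ← hc.deriv_eq_smul_unitTangent]
  rw [this, ofReal_re]
  exact hc.norm_deriv_pos t

/-- The integral over a period is constant on each side, so the difference is the jump at `c 0`; the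
period is centred to make `0` an interior parameter. -/
theorem cauchyIntegral_leftSide_sub_rightSide {x y : ℂ} (hx : x ∈ leftSide c)
    (hy : y ∈ rightSide c) : cauchyIntegral c (-(ℓ / 2)) (ℓ / 2) x -
      cauchyIntegral c (-(ℓ / 2)) (ℓ / 2) y = 2 * Real.pi * I := by
  have hℓ := hc.period_pos
  have hjump := tendsto_cauchyIntegral_jump (a := -(ℓ / 2)) (b := ℓ / 2) hc.contDiff_one (m := 0)
    ⟨by linarith, by linarith⟩ (hc.deriv_div_normal_re 0).1 (hc.deriv_div_normal_re 0).2
    (fun t ht he => by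
      rcases le_total 0 t with h | h
      · exact hc.eq_of_mem_Ico ⟨h, by linarith [ht.2]⟩ he
      · exact (hc.eq_of_mem_Ico ⟨h, by linarith [ht.1]⟩ he.symm).symm)
  refine tendsto_nhds_unique (tendsto_const_nhds.congr' ?_) hjump
  filter_upwards [hc.eventually_mem_leftSide 0, hc.eventually_mem_rightSide 0] with ε h1 h2
  rw [eq_of_hasDerivAt_zero hc.isOpen_compl_range (fun x => hc.hasDerivAt_cauchyIntegral_period)
    hc.isPreconnected_leftSide (leftSide_subset c) hx h1,
    eq_of_hasDerivAt_zero hc.isOpen_compl_range (fun x => hc.hasDerivAt_cauchyIntegral_period)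
    hc.isPreconnected_rightSide (rightSide_subset c) hy h2]
  rfl

theorem disjoint_sides : Disjoint (leftSide c) (rightSide c) := by
  rw [disjoint_left]
  intro x h1 h2
  have := hc.cauchyIntegral_leftSide_sub_rightSide h1 h2
  rw [sub_self] at this
  exact two_pi_I_ne_zero this.symm

/-- The complement of the curve consists of its two sides. -/
theorem mem_leftSide_or_mem_rightSide {x : ℂ} (hx : x ∈ (range c)ᶜ) :
    x ∈ leftSide c ∨ x ∈ rightSide c := by
  -- The segment from `x` to a nearest point `c t` is normal to the curve and meets it only at `c
  -- t`, so it joins `x` to one of the two strips.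
  obtain ⟨-, ⟨t, rfl⟩, ht⟩ := hc.isCompact_range.exists_infDist_eq_dist (range_nonempty c) x
  have hmin : ∀ s, ‖x - c t‖ ≤ ‖x - c s‖ := fun s => by
    rw [← dist_eq_norm, ← dist_eq_norm, ← ht]
    exact Metric.infDist_le_dist_of_mem ⟨s, rfl⟩
  have horth : (unitTangent c t).re * (x - c t).re + (unitTangent c t).im * (x - c t).im = 0 := by
    have hloc : IsLocalMin (fun s => (x.re - (c s).re) ^ 2 + (x.im - (c s).im) ^ 2) t :=
      Eventually.of_forall fun s => by
        have := pow_le_pow_left₀ (norm_nonneg _) (hmin s) 2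
        rw [Complex.sq_norm, Complex.sq_norm, normSq_apply, normSq_apply] at this
        simp only [sub_re, sub_im] at this
        linarith
    have hr := (reCLM.hasFDerivAt.comp_hasDerivAt t (hc.hasDerivAt t)).const_sub x.re
    have hi := (imCLM.hasFDerivAt.comp_hasDerivAt t (hc.hasDerivAt t)).const_sub x.im
    have h0 := hloc.hasDerivAt_eq_zero ((hr.pow 2).add (hi.pow 2))
    rw [hc.deriv_eq_smul_unitTangent] at h0
    simp only [Function.comp_apply, reCLM_apply, imCLM_apply, smul_re, smul_im, smul_eq_mul] at h0
    have hp := hc.norm_deriv_pos t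
    refine (mul_eq_zero.1 (?_ : ‖deriv c t‖ * _ = 0)).resolve_left hp.ne'
    rw [sub_re, sub_im]
    norm_num at h0
    linarith
  obtain ⟨a, ha⟩ : ∃ a : ℝ, x - c t = a * unitNormal c t := by
    refine ⟨(unitNormal c t).re * (x - c t).re + (unitNormal c t).im * (x - c t).im, ?_⟩
    have h1 := hc.unitTangent_re_sq_add_im_sq t
    apply Complex.ext
    · rw [re_ofReal_mul, unitNormal_re, unitNormal_im]
      linear_combination (-(x - c t).re) * h1 + (unitTangent c t).re * horth
    · rw [im_ofReal_mul, unitNormal_re, unitNormal_im]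
      linear_combination (-(x - c t).im) * h1 + (unitTangent c t).im * horth
  have ha0 : a ≠ 0 := by
    rintro rfl
    refine hx ⟨t, ?_⟩
    rw [ofReal_zero, zero_mul] at ha
    exact (sub_eq_zero.1 ha).symm
  have hxt : 0 < ‖x - c t‖ := norm_pos_iff.2 (sub_ne_zero.2 fun h => hx ⟨t, h.symm⟩)
  have hT : IsPreconnected ((fun θ : ℝ => c t + θ * (x - c t)) '' Ioc 0 1) :=
    isPreconnected_Ioc.image _ (by fun_prop)
  have hTS : (fun θ : ℝ => c t + θ * (x - c t)) '' Ioc 0 1 ⊆ (range c)ᶜ := by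
    rintro _ ⟨θ, hθ, rfl⟩ ⟨s, hs⟩
    have h1 := hmin s
    rw [hs, show x - (c t + θ * (x - c t)) = ((1 - θ : ℝ) : ℂ) * (x - c t) by push_cast; ring,
      norm_mul, norm_real, Real.norm_of_nonneg (by linarith [hθ.2])] at h1
    nlinarith [hθ.1]
  have hxT : x ∈ (fun θ : ℝ => c t + θ * (x - c t)) '' Ioc 0 1 := ⟨1, ⟨one_pos, le_rfl⟩, by simp⟩
  have habs := abs_pos.2 ha0
  have hmem : ∀ {ε : ℝ}, 0 < ε → ε < |a| → ∀ σ : ℝ, a = σ * |a| →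
      c t + (σ * ε : ℝ) * unitNormal c t ∈ (fun θ : ℝ => c t + θ * (x - c t)) '' Ioc 0 1 := by
    intro ε h1 h2 σ hσ
    refine ⟨ε / |a|, ⟨by positivity, (div_le_one habs).2 h2.le⟩, ?_⟩
    have : (σ * ε : ℝ) = ε / |a| * a := by
      rw [show ε / |a| * a = ε / |a| * (σ * |a|) from congrArg _ hσ]
      field_simp
    simp only [ha]
    rw [this]
    push_cast
    ring
  rcases ha0.lt_or_gt with h | h
  · right
    obtain ⟨ε, h1, h2⟩ := ((hc.eventually_mem_rightSide t).and (Ioo_mem_nhdsGT habs)).exists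
    refine subset_rightSide hT hTS ?_ h1 hxT
    have := hmem h2.1 h2.2 (-1) (by rw [abs_of_neg h]; ring)
    rwa [neg_one_mul, ofReal_neg, neg_mul, ← sub_eq_add_neg] at this
  · left
    obtain ⟨ε, h1, h2⟩ := ((hc.eventually_mem_leftSide t).and (Ioo_mem_nhdsGT habs)).exists
    refine subset_leftSide hT hTS ?_ h1 hxT
    have := hmem h2.1 h2.2 1 (by rw [abs_of_pos h]; ring)
    rwa [one_mul] at this

theorem exists_far : ∃ r > 0, ∀ x : ℂ, r < ‖x‖ → x ∈ (range c)ᶜ ∧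
    cauchyIntegral c (-(ℓ / 2)) (ℓ / 2) x = 0 := by
  obtain ⟨r, hr, hbd⟩ := hc.isCompact_range.isBounded.exists_pos_norm_le
  refine ⟨r, hr, fun x hx => ⟨fun h => (hbd x h).not_gt hx, ?_⟩⟩
  have hx0 : x ≠ 0 := norm_pos_iff.1 (hr.trans hx)
  rw [cauchyIntegral_eq_log_sub_log hc.contDiff_one (w := -x),
    ← hc.periodic (-(ℓ / 2)), show -(ℓ / 2) + ℓ = ℓ / 2 by ring, sub_self]
  intro t _
  have : (c t - x) / -x = 1 + -(c t) / x := by field_simp; ring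
  rw [this]
  refine mem_slitPlane_of_norm_lt_one ?_
  rw [norm_div, norm_neg, div_lt_one (norm_pos_iff.2 hx0)]
  exact (hbd _ ⟨t, rfl⟩).trans_lt hx

/-- Exactly one of the two sides of the curve is bounded. -/
theorem isBounded_sides :
    (Bornology.IsBounded (leftSide c) ∧ ¬ Bornology.IsBounded (rightSide c)) ∨
      (¬ Bornology.IsBounded (leftSide c) ∧ Bornology.IsBounded (rightSide c)) := by
  obtain ⟨r, hr, hfar⟩ := hc.exists_far
  -- The far region is connected and off the curve, so one side contains it and the other is
  -- confined to a ball.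
  have hpre : IsPreconnected {x : ℂ | r < ‖x‖} := by
    simpa using isPreconnected_compl_closedBall 0 hr.le
  have hsub : {x : ℂ | r < ‖x‖} ⊆ (range c)ᶜ := fun x hx => (hfar x hx).1
  have hunb : ∀ {T : Set ℂ}, {x : ℂ | r < ‖x‖} ⊆ T → ¬ Bornology.IsBounded T := by
    intro T hT hb
    obtain ⟨R, hR, hbd⟩ := hb.exists_pos_norm_le
    have hn : ‖((r + R : ℝ) : ℂ)‖ = r + R := by
      rw [norm_real, Real.norm_of_nonneg (by positivity)]
    have := hbd ((r + R : ℝ) : ℂ) (hT (show r < ‖((r + R : ℝ) : ℂ)‖ by rw [hn]; linarith))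
    rw [hn] at this
    linarith
  have hbdd : ∀ {T : Set ℂ}, Disjoint {x : ℂ | r < ‖x‖} T → Bornology.IsBounded T := by
    intro T hT
    refine (Metric.isBounded_closedBall (x := (0 : ℂ)) (r := r)).subset fun x hx => ?_
    rw [mem_closedBall_zero_iff]
    by_contra! hcon
    exact disjoint_left.1 hT hcon hx
  have hmem : ((r + 1 : ℝ) : ℂ) ∈ {x : ℂ | r < ‖x‖} := by
    show r < _
    rw [norm_real, Real.norm_of_nonneg (by positivity)]
    linarith
  rcases hc.mem_leftSide_or_mem_rightSide (hsub hmem) with h | h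
  · have hs := subset_leftSide hpre hsub hmem h
    exact Or.inr ⟨hunb hs, hbdd (hc.disjoint_sides.mono_left hs)⟩
  · have hs := subset_rightSide hpre hsub hmem h
    exact Or.inl ⟨hbdd (hc.disjoint_sides.symm.mono_left hs), hunb hs⟩

/-- The disk bounded by a tangent circline that supports the curve lies on the left. -/
theorem mem_leftSide_of_circlineFun_nonneg {κ t : ℝ}
    (h : ∀ s, circlineFun κ (unitNormal c t) (c t) (c s) ≤ 0) {x : ℂ} (hx : x ∈ (range c)ᶜ)
    (hx0 : 0 ≤ circlineFun κ (unitNormal c t) (c t) x) : x ∈ leftSide c := by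
  have hn := hc.unitNormal_re_sq_add_im_sq t
  obtain ⟨ε, h1, h2⟩ := ((hc.eventually_mem_leftSide t).and
    (eventually_circlineFun_add_pos (κ := κ) (p := c t) hn)).exists
  have hpos : {y | 0 < circlineFun κ (unitNormal c t) (c t) y} ⊆ (range c)ᶜ := by
    rintro _ hy ⟨s, rfl⟩
    exact (h s).not_gt hy
  -- A connected set stays connected when a point of its closure is added, which covers `x` on the
  -- circline itself.
  have hT := (isPreconnected_circlineFun_pos (κ := κ) (p := c t) hn).subset_closure
    (subset_insert x _) (insert_subset (by
      rcases hx0.eq_or_lt with h0 | h0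
      · exact mem_closure_circlineFun_pos hn h0.symm
      · exact subset_closure h0) subset_closure)
  exact subset_leftSide hT (insert_subset hx hpos) (mem_insert_of_mem _ h2) h1 (mem_insert _ _)

end IsSimpleLoop

/-! ### Supporting disks do not interleave. -/

/-- In the coordinate `u = (B - x) / (A - x)` a circline is again given by a quadratic function. -/
theorem exists_circlineFun_cross (κ : ℝ) (n p A B : ℂ) : ∃ β : ℂ, ∀ x u : ℂ, u * (A - x) = B - x →
    normSq (1 - u) * circlineFun κ n p x = normSq u * circlineFun κ n p A +
      (β.re * u.re + β.im * u.im) + circlineFun κ n p B := by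
  obtain ⟨A', hA⟩ : ∃ A', A' = A - p := ⟨_, rfl⟩
  obtain ⟨B', hB⟩ : ∃ B', B' = B - p := ⟨_, rfl⟩
  -- The coefficients of the terms linear in `u`, read off after substituting `(1 - u) (x - p) = (B
  -- - p) - u (A - p)`.
  refine ⟨⟨-2 * (n.re * A'.re + n.im * A'.im) - 2 * (n.re * B'.re + n.im * B'.im) +
      2 * κ * (B'.re * A'.re + B'.im * A'.im),
    2 * (n.re * A'.im - n.im * A'.re) - 2 * (n.re * B'.im - n.im * B'.re) +
      2 * κ * (B'.im * A'.re - B'.re * A'.im)⟩, fun x u h => ?_⟩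
  obtain ⟨y, hy⟩ : ∃ y, y = x - p := ⟨_, rfl⟩
  have hw : (1 - u) * y = B' - u * A' := by
    rw [hy, hA, hB]
    linear_combination h
  have hr := congrArg re hw
  have hi := congrArg im hw
  simp only [mul_re, mul_im, sub_re, sub_im, one_re, one_im] at hr hi
  simp only [circlineFun, normSq_apply, ← sub_re, ← sub_im, ← hA, ← hB, ← hy]
  simp only [sub_re, sub_im, one_re, one_im]
  linear_combination (2 * n.re * (1 - u.re) + 2 * n.im * u.im - κ * ((1 - u.re) * y.re +
    u.im * y.im + (B'.re - (u.re * A'.re - u.im * A'.im)))) * hr +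
    (-2 * n.re * u.im + 2 * n.im * (1 - u.re) - κ * ((1 - u.re) * y.im - u.im * y.re +
    (B'.im - (u.re * A'.im + u.im * A'.re)))) * hi

/-- A primitive of `1 / (A - x) - 1 / (B - x)` off one of the two arcs with ends `A` and `B` of a
circline, which is chosen such that it does not meet a given disk. -/
theorem exists_primitive_off_arc {κ₁ κ₂ : ℝ} {n₁ p₁ n₂ p₂ A B z : ℂ} (hAB : A ≠ B)
    (hA₁ : circlineFun κ₁ n₁ p₁ A = 0) (hB₁ : circlineFun κ₁ n₁ p₁ B = 0)
    (hz : circlineFun κ₁ n₁ p₁ z ≠ 0)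
    (hA₂ : circlineFun κ₂ n₂ p₂ A ≤ 0) (hB₂ : circlineFun κ₂ n₂ p₂ B ≤ 0) :
    ∃ G : ℂ → ℂ, ∀ x, x ≠ A → (circlineFun κ₁ n₁ p₁ x ≠ 0 ∨ 0 < circlineFun κ₂ n₂ p₂ x) →
      HasDerivAt G (1 / (A - x) - 1 / (B - x)) x := by
  obtain ⟨β₁, h₁⟩ := exists_circlineFun_cross κ₁ n₁ p₁ A B
  obtain ⟨β₂, h₂⟩ := exists_circlineFun_cross κ₂ n₂ p₂ A B
  rw [hA₁, hB₁] at h₁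
  have hu : ∀ x, x ≠ A → (B - x) / (A - x) * (A - x) = B - x := fun x hx =>
    div_mul_cancel₀ _ (sub_ne_zero.2 hx.symm)
  have hu1 : ∀ x, x ≠ A → 0 < normSq (1 - (B - x) / (A - x)) := fun x hx => by
    refine normSq_pos.2 fun h => hAB ?_
    have := hu x hx
    rw [← sub_eq_zero.1 h, one_mul] at this
    exact sub_left_injective this
  have hβ₁ : β₁ ≠ 0 := by
    rintro rfl
    have hzA : z ≠ A := fun h => hz (h ▸ hA₁)
    have := h₁ z _ (hu z hzA)
    simp only [zero_re, zero_im, mul_zero, zero_mul, add_zero, mul_eq_zero] at this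
    exact this.elim (hu1 z hzA).ne' hz
  -- In the coordinate `u` the first circline is a line through `0`. Of its two rays, `r` spans one
  -- on which the form of the second circline is a sum of nonpositive terms, so this ray avoids the
  -- second disk; it becomes the cut of the logarithm.
  obtain ⟨r, hr0, hr1, hr2⟩ : ∃ r : ℂ, r ≠ 0 ∧ β₁.re * r.re + β₁.im * r.im = 0 ∧
      β₂.re * r.re + β₂.im * r.im ≤ 0 := by
    have hI : I * β₁ ≠ 0 := mul_ne_zero I_ne_zero hβ₁
    rcases le_total (β₂.re * (I * β₁).re + β₂.im * (I * β₁).im) 0 with h | h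
    · exact ⟨I * β₁, hI, by simp; ring, h⟩
    · refine ⟨-(I * β₁), neg_ne_zero.2 hI, by simp; ring, ?_⟩
      rw [neg_re, neg_im]
      linarith
  refine ⟨fun x => log (-((B - x) / (A - x)) / r), fun x hx hQ => ?_⟩
  have hxA := sub_ne_zero.2 hx.symm
  have hslit : -((B - x) / (A - x)) / r ∈ slitPlane := by
    by_contra hcon
    rw [mem_slitPlane_iff, not_or, not_lt, not_not] at hcon
    obtain ⟨l, hl⟩ : ∃ l : ℝ, l = -(-((B - x) / (A - x)) / r).re := ⟨_, rfl⟩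
    have hl0 : 0 ≤ l := by linarith [hcon.1]
    have hul : (B - x) / (A - x) = l * r := by
      have : -((B - x) / (A - x)) / r = ((-l : ℝ) : ℂ) :=
        Complex.ext (by rw [ofReal_re, hl, neg_neg]) (by rw [ofReal_im, hcon.2])
      rw [div_eq_iff hr0] at this
      push_cast at this
      linear_combination -this
    have e1 := h₁ x _ (hu x hx)
    have e2 := h₂ x _ (hu x hx)
    have hp := hu1 x hx
    rw [hul] at e1 e2 hp
    rw [re_ofReal_mul, im_ofReal_mul] at e1 e2
    rcases hQ with hQ | hQ
    · refine hQ ((mul_eq_zero.1 ?_).resolve_left hp.ne')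
      rw [e1]
      linear_combination l * hr1
    · have := mul_pos hp hQ
      have h3 := mul_nonpos_of_nonneg_of_nonpos (normSq_nonneg (l * r)) hA₂
      have h4 := mul_nonpos_of_nonneg_of_nonpos hl0 hr2
      linarith
  have hxB : B - x ≠ 0 := by
    intro h
    rw [h] at hslit
    simp at hslit
  have hd : HasDerivAt (fun x => -((B - x) / (A - x)) / r)
      (-((-1 * (A - x) - (B - x) * -1) / (A - x) ^ 2) / r) x :=
    (((((hasDerivAt_id x).const_sub B).div ((hasDerivAt_id x).const_sub A) hxA)).neg).div_const r
  refine (hd.clog hslit).congr_deriv ?_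
  field_simp
  ring

namespace IsSimpleLoop

variable {c : ℝ → ℂ} {ℓ : ℝ} (hc : IsSimpleLoop c ℓ)
include hc

/-- A supporting circline is tangent to the curve, with the same orientation, wherever it meets the
curve. -/
theorem recenter_eq_unitNormal {κ t s : ℝ}
    (h : ∀ r, circlineFun κ (unitNormal c t) (c t) (c r) ≤ 0)
    (hs : circlineFun κ (unitNormal c t) (c t) (c s) = 0) :
    unitNormal c t - κ * (c s - c t) = unitNormal c s ∧
      ∀ y, circlineFun κ (unitNormal c s) (c s) y = circlineFun κ (unitNormal c t) (c t) y := by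
  obtain ⟨m, hm, hm1, hmy⟩ := exists_recenter (hc.unitNormal_re_sq_add_im_sq t) hs
  suffices m = unitNormal c s by
    rw [← hm, ← this]
    exact ⟨rfl, hmy⟩
  have hT := hc.unitTangent_re_sq_add_im_sq s
  have hr := (reCLM.hasFDerivAt.comp_hasDerivAt s (hc.hasDerivAt s)).sub_const (c s).re
  have hi := (imCLM.hasFDerivAt.comp_hasDerivAt s (hc.hasDerivAt s)).sub_const (c s).im
  -- Along the curve the function has its maximum `0` at `s`, so `m` is orthogonal to the tangent
  -- there and equals plus or minus the unit normal. The minus sign would put points of the right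
  -- side into the disk, which lies on the left.
  have hloc : IsLocalMax (fun r => circlineFun κ m (c s) (c r)) s :=
    Eventually.of_forall fun r => by
      show circlineFun κ m (c s) (c r) ≤ circlineFun κ m (c s) (c s)
      rw [circlineFun_self, hmy]
      exact h r
  have h0 := hloc.hasDerivAt_eq_zero (((hr.const_mul m.re).add (hi.const_mul m.im)).const_mul 2 |>.sub
    (((hr.pow 2).add (hi.pow 2)).const_mul κ))
  rw [hc.deriv_eq_smul_unitTangent] at h0
  have horth : m.re * (unitTangent c s).re + m.im * (unitTangent c s).im = 0 := by
    refine (mul_eq_zero.1 (?_ : ‖deriv c s‖ * _ = 0)).resolve_left (hc.norm_deriv_pos s).ne'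
    simp only [Function.comp_apply, reCLM_apply, imCLM_apply, smul_re, smul_im, smul_eq_mul] at h0
    norm_num at h0
    linarith
  obtain ⟨σ, hσ⟩ : ∃ σ, σ = m.im * (unitTangent c s).re - m.re * (unitTangent c s).im := ⟨_, rfl⟩
  have hmσ : m = σ * unitNormal c s := by
    apply Complex.ext
    · rw [re_ofReal_mul, unitNormal_re, hσ]
      linear_combination (-m.re) * hT + (unitTangent c s).re * horth
    · rw [im_ofReal_mul, unitNormal_im, hσ]
      linear_combination (-m.im) * hT + (unitTangent c s).im * horth
  have hσ2 : σ ^ 2 = 1 := by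
    rw [hσ]
    linear_combination hm1 + (m.re ^ 2 + m.im ^ 2) * hT -
      (m.re * (unitTangent c s).re + m.im * (unitTangent c s).im) * horth
  rw [sq, mul_self_eq_one_iff] at hσ2
  rcases hσ2 with h1 | h1
  · rw [hmσ, h1, ofReal_one, one_mul]
  · exfalso
    obtain ⟨ε, hε1, hε2⟩ := ((hc.eventually_mem_rightSide s).and
      (eventually_circlineFun_add_pos (κ := κ) (p := c s) hm1)).exists
    rw [hmy, hmσ, h1, ofReal_neg, ofReal_one, neg_one_mul, mul_neg, ← sub_eq_add_neg] at hε2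
    exact disjoint_left.1 hc.disjoint_sides
      (hc.mem_leftSide_of_circlineFun_nonneg h hε1.1 hε2.le) hε1

/-- Recentred at `c s`, the circline of `t` supports the curve, which bounds `maxCurvature c ℓ s`
from above. If the curvature at `s` were strictly smaller and `c s ≠ c t`, then `c t` would lie in
the open disk of `s`. -/
theorem touches_eq {t s : ℝ} (h : Touches c ℓ t s) :
    maxCurvature c ℓ s = maxCurvature c ℓ t ∧ ∀ y,
      circlineFun (maxCurvature c ℓ s) (unitNormal c s) (c s) y =
        circlineFun (maxCurvature c ℓ t) (unitNormal c t) (c t) y := by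
  obtain ⟨h1, h2⟩ := hc.recenter_eq_unitNormal (hc.circlineFun_maxCurvature_nonpos t) h
  suffices maxCurvature c ℓ s = maxCurvature c ℓ t by
    rw [this]
    exact ⟨rfl, h2⟩
  refine le_antisymm (hc.maxCurvature_le fun r => ?_) ?_
  · rw [h2]
    exact hc.circlineFun_maxCurvature_nonpos t r
  · rcases eq_or_ne (c s) (c t) with he | hne
    · rw [he, sub_self, mul_zero, sub_zero] at h1
      refine hc.maxCurvature_le fun r => ?_
      rw [h1, ← he]
      exact hc.circlineFun_maxCurvature_nonpos s r
    · have h3 := h2 (c t)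
      have h4 := hc.circlineFun_maxCurvature_nonpos s t
      have h5 := normSq_pos.2 (sub_ne_zero.2 hne)
      rw [circlineFun_self] at h3
      rw [normSq_apply, sub_re, sub_im] at h5
      simp only [circlineFun] at h3 h4
      by_contra! hcon
      nlinarith

theorem touches_symm {t s : ℝ} (h : Touches c ℓ t s) : Touches c ℓ s t := by
  rw [Touches, (hc.touches_eq h).2, circlineFun_self]

theorem touches_trans {t s r : ℝ} (h : Touches c ℓ t s) (h' : Touches c ℓ s r) :
    Touches c ℓ t r := by
  rw [Touches, ← (hc.touches_eq h).2]
  exact h'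

/-- Two supporting disks do not interleave along the curve. -/
theorem touches_of_interleaved {a m b s : ℝ} (ham : a < m) (hmb : m < b) (hbs : b < s)
    (hsa : s < a + ℓ) (hab : Touches c ℓ a b) (hms : Touches c ℓ m s) : Touches c ℓ a m := by
  by_contra hcon
  have has : ¬ Touches c ℓ a s := fun h => hcon (hc.touches_trans h (hc.touches_symm hms))
  have hmem : ∀ x ∈ (range c)ᶜ, circlineFun (maxCurvature c ℓ a) (unitNormal c a) (c a) x = 0 →
      x ∈ leftSide c := fun x hx h =>
    hc.mem_leftSide_of_circlineFun_nonneg (hc.circlineFun_maxCurvature_nonpos a) hx h.ge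
  obtain ⟨ε₀, hε₀⟩ := (eventually_circlineFun_sub_neg (κ := maxCurvature c ℓ a) (p := c a)
    (hc.unitNormal_re_sq_add_im_sq a)).exists
  -- `G` has the derivative of the Cauchy integral over `[a, b]`; its cut is part of the circline of
  -- `a` and avoids the open disk of `m`.
  obtain ⟨G, hG⟩ := exists_primitive_off_arc (A := c a) (B := c b) (κ₂ := maxCurvature c ℓ m)
    (n₂ := unitNormal c m) (p₂ := c m)
    (hc.ne_of_mem_Ioo (s := b) (t := a) ⟨by linarith, by linarith⟩).symm circlineFun_self hab hε₀.ne
    (hc.circlineFun_maxCurvature_nonpos m a) (hc.circlineFun_maxCurvature_nonpos m b)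
  -- On `U` the difference of the Cauchy integral and `G` is locally constant. `U` contains the disk
  -- of `m`, the right side (points of the circline of `a` off the curve lie on the left) and `c s`.
  obtain ⟨U, hU⟩ : ∃ U : Set ℂ, U = (c '' uIcc a b)ᶜ ∩
    ({x | circlineFun (maxCurvature c ℓ a) (unitNormal c a) (c a) x ≠ 0} ∪
      {x | 0 < circlineFun (maxCurvature c ℓ m) (unitNormal c m) (c m) x}) := ⟨_, rfl⟩
  have hUo : IsOpen U := by
    rw [hU]
    exact (isClosed_image_uIcc hc.continuous).isOpen_compl.inter
      ((isOpen_ne_fun continuous_circlineFun continuous_const).union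
        (isOpen_lt continuous_const continuous_circlineFun))
  have hV : ∀ x ∈ U, HasDerivAt (fun x => cauchyIntegral c a b x - G x) 0 x := by
    intro x hx
    rw [hU] at hx
    refine ((hasDerivAt_cauchyIntegral hc.contDiff_one hx.1).sub
      (hG x (fun h => hx.1 ⟨a, left_mem_uIcc, h.symm⟩) hx.2)).congr_deriv (sub_self _)
  have hDU : {x | 0 < circlineFun (maxCurvature c ℓ m) (unitNormal c m) (c m) x} ⊆ U := by
    intro x hx
    rw [hU]
    refine ⟨?_, Or.inr hx⟩
    rintro ⟨r, -, rfl⟩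
    exact (hc.circlineFun_maxCurvature_nonpos m r).not_gt hx
  have hRU : rightSide c ⊆ U := by
    intro x hx
    rw [hU]
    exact ⟨fun h => hx.1 (image_subset_range _ _ h), Or.inl fun h =>
      disjoint_left.1 hc.disjoint_sides (hmem x hx.1 h) hx⟩
  have hsU : c s ∈ U := by
    rw [hU]
    refine ⟨?_, Or.inl has⟩
    rintro ⟨r, hr, he⟩
    rw [uIcc_of_le (ham.trans hmb).le] at hr
    exact hc.ne_of_mem_Ioo (s := s) (t := r) ⟨by linarith [hr.2], by linarith [hr.1]⟩ he.symm
  have hdisk : ∀ᶠ ε : ℝ in 𝓝[>] 0,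
      0 < circlineFun (maxCurvature c ℓ m) (unitNormal c m) (c m) (c s + ε * unitNormal c s) := by
    filter_upwards [eventually_circlineFun_add_pos (κ := maxCurvature c ℓ s) (p := c s)
      (hc.unitNormal_re_sq_add_im_sq s)] with ε hε
    rwa [(hc.touches_eq hms).2] at hε
  have hlim : ∀ (F : ℂ → ℂ) (r : ℝ), ContinuousAt F (c r) →
      Tendsto (fun ε : ℝ => F (c r + ε * unitNormal c r) - F (c r - ε * unitNormal c r))
        (𝓝[>] 0) (𝓝 0) := by
    intro F r hF
    have h1 : ContinuousAt (fun ε : ℝ => F (c r + ε * unitNormal c r) -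
        F (c r - ε * unitNormal c r)) 0 := by
      refine ContinuousAt.sub (ContinuousAt.comp (g := F) ?_ (by fun_prop))
        (ContinuousAt.comp (g := F) ?_ (by fun_prop)) <;> simpa
    simpa using h1.tendsto.mono_left (nhdsWithin_le_nhds (s := Ioi 0))
  -- At `c m`, which is not on the circline of `a`, `G` is continuous and the difference jumps by
  -- `2πi`; at `c s` it is continuous. The disk of `m` joins the left banks of `c m` and `c s`, the
  -- right side joins their right banks, so the jumps are equal.
  have hjump := (tendsto_cauchyIntegral_jump (a := a) (b := b) hc.contDiff_one (m := m) ⟨ham, hmb⟩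
    (hc.deriv_div_normal_re m).1 (hc.deriv_div_normal_re m).2
    (fun t ht he => by
      rcases le_total m t with h | h
      · exact hc.eq_of_mem_Ico ⟨h, by linarith [ht.2]⟩ he
      · exact (hc.eq_of_mem_Ico ⟨h, by linarith [ht.1]⟩ he.symm).symm)).sub
    (hlim G m (hG (c m) (hc.ne_of_mem_Ioo ⟨ham, by linarith⟩) (Or.inl hcon)).continuousAt)
  rw [sub_zero] at hjump
  refine two_pi_I_ne_zero (tendsto_nhds_unique hjump ((hlim _ s (hV _ hsU).continuousAt).congr' ?_))
  filter_upwards [hdisk, eventually_circlineFun_add_pos (κ := maxCurvature c ℓ m) (p := c m)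
      (hc.unitNormal_re_sq_add_im_sq m), hc.eventually_mem_rightSide s,
    hc.eventually_mem_rightSide m] with ε h1 h2 h3 h4
  have e1 := eq_of_hasDerivAt_zero hUo hV
    (isPreconnected_circlineFun_pos (hc.unitNormal_re_sq_add_im_sq m)) hDU h1 h2
  have e2 := eq_of_hasDerivAt_zero hUo hV hc.isPreconnected_rightSide hRU h3 h4
  rw [e1, e2]
  simp only [unitNormal]
  ring

/-! ### Osculating circlines that support the curve. -/

theorem exists_maxCurvature_eq_curvature_Icc {a b : ℝ} (hab : a < b) (hb : b < a + ℓ)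
    (h : Touches c ℓ a b) : ∃ x ∈ Icc a b, maxCurvature c ℓ x = curvature c x := by
  have hℓ := hc.period_pos
  -- Pairs `(x, h)` with both `x` and `x + h` in `[a, b]`. Keeping `h = 0` makes the set compact; a
  -- minimal solution with `h = 0` is an osculating point.
  obtain ⟨D, hD⟩ : ∃ D : Set (ℝ × ℝ),
      D = (Icc a b ×ˢ Icc 0 (b - a)) ∩ {p | p.1 + p.2 ≤ b} := ⟨_, rfl⟩
  have hDc : IsCompact D := by
    rw [hD]
    exact (isCompact_Icc.prod isCompact_Icc).inter_right (isClosed_le (by fun_prop) (by fun_prop))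
  have hcont : ContinuousOn (fun p : ℝ × ℝ => chordCurvature c p.1 p.2 - maxCurvature c ℓ p.1) D := by
    refine (hc.continuousOn_chordCurvature.mono fun p hp => ?_).sub
      (hc.continuous_maxCurvature.comp continuous_fst).continuousOn
    rw [hD] at hp
    exact ⟨trivial, by linarith [hp.1.2.1], by linarith [hp.1.2.2]⟩
  have hZ : IsCompact (D ∩ (fun p : ℝ × ℝ => chordCurvature c p.1 p.2 - maxCurvature c ℓ p.1) ⁻¹'
      {0}) :=
    hDc.of_isClosed_subset (hcont.preimage_isClosed_of_isClosed hDc.isClosed isClosed_singleton)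
      inter_subset_left
  have hmemZ : ∀ {x y}, a ≤ x → x < y → y ≤ b → Touches c ℓ x y → (x, y - x) ∈
      D ∩ (fun p : ℝ × ℝ => chordCurvature c p.1 p.2 - maxCurvature c ℓ p.1) ⁻¹' {0} := by
    intro x y hax hxy hyb hT
    rw [← add_sub_cancel x y, hc.touches_add_iff (by linarith) (by linarith) (by linarith)] at hT
    rw [hD]
    exact ⟨⟨⟨⟨hax, by linarith⟩, by linarith, by linarith⟩, by simpa⟩, sub_eq_zero.2 hT⟩
  obtain ⟨⟨x, h'⟩, ⟨hxD, hx0⟩, hmin⟩ := hZ.exists_isMinOn ⟨_, hmemZ le_rfl hab le_rfl h⟩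
    continuous_snd.continuousOn
  have hx0' : chordCurvature c x h' = maxCurvature c ℓ x := sub_eq_zero.1 hx0
  rw [hD] at hxD
  obtain ⟨⟨⟨hax, hxb⟩, h0, hle⟩, hxhb⟩ := hxD
  have hxhb' : x + h' ≤ b := hxhb
  simp only at hax hxb h0 hle
  rcases h0.eq_or_lt with rfl | hpos
  · rw [hc.chordCurvature_zero] at hx0'
    exact ⟨x, ⟨hax, hxb⟩, hx0'.symm⟩
  · have hT : Touches c ℓ x (x + h') :=
      (hc.touches_add_iff (by linarith) (by linarith) hpos.ne').2 hx0'
    have hno : ∀ {y z}, a ≤ y → y < z → z ≤ b → z - y < h' → ¬ Touches c ℓ y z :=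
      fun h1 h2 h3 h4 h5 => h4.not_ge (hmin (hmemZ h1 h2 h3 h5))
    -- If the midpoint of an innermost pair touched another point, then that point would form a
    -- shorter pair with it, or the two pairs would interleave and `x` would touch `m`.
    obtain ⟨m, hm⟩ : ∃ m, m = x + h' / 2 := ⟨_, rfl⟩
    rcases hc.maxCurvature_eq_or_exists_touches m with hK | ⟨s, hs, hms⟩
    · exact ⟨m, ⟨by linarith, by linarith⟩, hK⟩
    · exfalso
      have hs1 := hs.1
      have hs2 := hs.2
      rcases le_or_gt s (x + h') with h1 | h1
      · exact hno (by linarith) hs1 (by linarith) (by linarith) hms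
      rcases lt_trichotomy s (x + ℓ) with h2 | h2 | h2
      · exact hno hax (by linarith) (by linarith) (by linarith)
          (hc.touches_of_interleaved (m := m) (by linarith) (by linarith) h1 h2 hT hms)
      · rw [h2, hc.touches_add_period] at hms
        exact hno hax (by linarith) (by linarith) (by linarith) (hc.touches_symm hms)
      · rw [← sub_add_cancel s ℓ, hc.touches_add_period] at hms
        exact hno (by linarith) (by linarith) (by linarith) (by linarith) (hc.touches_symm hms)

/-- A touching pair strictly inside `(a, b)` reduces this to the closed case. It exists if all
interior points touch `a`; otherwise take `m` that does not: by non-crossing it is osculating or has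
its partner inside `(a, b)`. -/
theorem exists_maxCurvature_eq_curvature_Ioo {a b : ℝ} (hab : a < b) (hb : b < a + ℓ)
    (h : Touches c ℓ a b) : ∃ x ∈ Ioo a b, maxCurvature c ℓ x = curvature c x := by
  have hsub : ∀ {y z}, a < y → y < z → z < b → Touches c ℓ y z →
      ∃ x ∈ Ioo a b, maxCurvature c ℓ x = curvature c x := by
    intro y z h1 h2 h3 h4
    obtain ⟨x, hx, hK⟩ := hc.exists_maxCurvature_eq_curvature_Icc h2 (by linarith) h4
    exact ⟨x, ⟨by linarith [hx.1], by linarith [hx.2]⟩, hK⟩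
  by_cases hall : ∀ m ∈ Ioo a b, Touches c ℓ a m
  · obtain ⟨y, hy1, hy2⟩ := exists_between hab
    obtain ⟨z, hz1, hz2⟩ := exists_between hy2
    exact hsub hy1 hz1 hz2 (hc.touches_trans (hc.touches_symm (hall y ⟨hy1, hy2⟩))
      (hall z ⟨hy1.trans hz1, hz2⟩))
  · push Not at hall
    obtain ⟨m, hm, ham⟩ := hall
    rcases hc.maxCurvature_eq_or_exists_touches m with hK | ⟨s, hs, hms⟩
    · exact ⟨m, hm, hK⟩
    · rcases lt_trichotomy s b with h1 | rfl | h1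
      · exact hsub hm.1 hs.1 h1 hms
      · exact absurd (hc.touches_trans h (hc.touches_symm hms)) ham
      rcases lt_trichotomy s (a + ℓ) with h2 | h2 | h2
      · exact absurd (hc.touches_of_interleaved hm.1 hm.2 h1 h2 h hms) ham
      · rw [h2, hc.touches_add_period] at hms
        exact absurd (hc.touches_symm hms) ham
      · rw [← sub_add_cancel s ℓ, hc.touches_add_period] at hms
        exact hsub (by linarith) (by linarith [hs.2]) hm.2 (hc.touches_symm hms)

/-- At two points at least, the osculating circline supports the curve from the left. -/
theorem exists_two_maxCurvature_eq_curvature : ∃ s₁ s₂, c s₁ ≠ c s₂ ∧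
    maxCurvature c ℓ s₁ = curvature c s₁ ∧ maxCurvature c ℓ s₂ = curvature c s₂ := by
  have hℓ := hc.period_pos
  by_cases hall : ∀ t, maxCurvature c ℓ t = curvature c t
  · exact ⟨ℓ / 2, 0, hc.ne_of_mem_Ioo ⟨by linarith, by linarith⟩, hall _, hall _⟩
  · push Not at hall
    obtain ⟨t, ht⟩ := hall
    obtain ⟨s, hs, hts⟩ := (hc.maxCurvature_eq_or_exists_touches t).resolve_left ht
    obtain ⟨x, hx, hxK⟩ := hc.exists_maxCurvature_eq_curvature_Ioo hs.1 hs.2 hts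
    obtain ⟨y, hy, hyK⟩ := hc.exists_maxCurvature_eq_curvature_Ioo (a := s) (b := t + ℓ) hs.2
      (by linarith [hs.1]) (hc.touches_add_period.2 (hc.touches_symm hts))
    exact ⟨y, x, hc.ne_of_mem_Ioo ⟨by linarith [hx.2, hy.1], by linarith [hy.2, hx.1]⟩, hyK, hxK⟩

end IsSimpleLoop

/-! ### Left and right supports, exchanged by reversal of the orientation. -/

/-- The point set of the osculating circline of `c` at `t`. -/
def osculatingSet (c : ℝ → ℂ) (t : ℝ) : Set ℂ :=
  {x | circlineFun (curvature c t) (unitNormal c t) (c t) x = 0}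

/-- The curve lies on the non-positive side of its osculating circline at `t`. -/
def SupportedFromLeft (c : ℝ → ℂ) (t : ℝ) : Prop :=
  ∀ s, circlineFun (curvature c t) (unitNormal c t) (c t) (c s) ≤ 0

/-- The curve lies on the non-negative side of its osculating circline at `t`. -/
def SupportedFromRight (c : ℝ → ℂ) (t : ℝ) : Prop :=
  ∀ s, 0 ≤ circlineFun (curvature c t) (unitNormal c t) (c t) (c s)

section Reverse

variable (c : ℝ → ℂ) (t : ℝ)

theorem unitTangent_reverse : unitTangent (fun s => c (-s)) t = -unitTangent c (-t) := by
  rw [unitTangent, unitTangent, deriv_comp_neg, norm_neg, smul_neg]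

theorem unitNormal_reverse : unitNormal (fun s => c (-s)) t = -unitNormal c (-t) := by
  rw [unitNormal, unitNormal, unitTangent_reverse, mul_neg]

theorem curvature_reverse : curvature (fun s => c (-s)) t = -curvature c (-t) := by
  rw [curvature, curvature, funext (unitTangent_reverse c), unitNormal_reverse, deriv_comp_neg,
    norm_neg, deriv.fun_neg, deriv_comp_neg, neg_neg, inner_neg_right, neg_div]

theorem range_reverse : range (fun s => c (-s)) = range c :=
  (neg_surjective (G := ℝ)).range_comp c

theorem leftSide_reverse : leftSide (fun s => c (-s)) = rightSide c := by
  simp only [leftSide, rightSide, range_reverse, unitNormal_reverse, neg_zero, mul_neg,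
    ← sub_eq_add_neg]

theorem circlineFun_reverse (x : ℂ) :
    circlineFun (curvature (fun s => c (-s)) t) (unitNormal (fun s => c (-s)) t) (c (-t)) x =
      -circlineFun (curvature c (-t)) (unitNormal c (-t)) (c (-t)) x := by
  rw [curvature_reverse, unitNormal_reverse, circlineFun_neg]

theorem osculatingSet_reverse : osculatingSet (fun s => c (-s)) t = osculatingSet c (-t) := by
  ext x
  simp only [osculatingSet, mem_ofPred_eq]
  rw [circlineFun_reverse, neg_eq_zero]

variable {c t}

theorem supportedFromLeft_reverse_iff :
    SupportedFromLeft (fun s => c (-s)) t ↔ SupportedFromRight c (-t) := by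
  simp only [SupportedFromLeft, SupportedFromRight, circlineFun_reverse, neg_nonpos]
  exact ⟨fun h s => by simpa using h (-s), fun h s => h _⟩

end Reverse

namespace IsSimpleLoop

variable {c : ℝ → ℂ} {ℓ : ℝ} (hc : IsSimpleLoop c ℓ)
include hc

theorem reverse : IsSimpleLoop (fun t => c (-t)) ℓ where
  smooth := hc.smooth.comp contDiff_neg
  regular t := by
    rw [deriv_comp_neg]
    exact neg_ne_zero.2 (hc.regular _)
  period_pos := hc.period_pos
  periodic t := by
    show c (-(t + ℓ)) = c (-t)
    rw [← hc.periodic (-(t + ℓ)), neg_add_rev, neg_add_cancel_comm]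
  simple := by
    intro x hx y hy h
    rcases le_total x y with h1 | h1
    · exact neg_injective (hc.eq_of_mem_Ico ⟨by linarith, by linarith [hx.1, hy.2]⟩ h)
    · exact neg_injective (hc.eq_of_mem_Ico ⟨by linarith, by linarith [hy.1, hx.2]⟩ h.symm).symm

theorem periodic_curvature : Function.Periodic (curvature c) ℓ := fun t => by
  rw [curvature, curvature, hc.periodic_deriv, hc.periodic_unitNormal, ← deriv_comp_add_const,
    funext hc.periodic_unitTangent]

theorem curvature_eq_of_eq {s t : ℝ} (h : c s = c t) :
    curvature c s = curvature c t ∧ unitNormal c s = unitNormal c t := by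
  have hper : Function.Periodic (fun t => (c t, curvature c t, unitNormal c t)) ℓ := fun t => by
    simp only [hc.periodic t, hc.periodic_unitNormal t, hc.periodic_curvature t]
  obtain ⟨y, hy, he⟩ := hper.exists_mem_Ico hc.period_pos s t
  have h1 := (Prod.mk.inj he).1
  rw [hc.eq_of_mem_Ico hy (h1.symm.trans h)] at he
  exact Prod.mk.inj (Prod.mk.inj he).2

theorem exists_two_supportedFromLeft : ∃ s₁ s₂, c s₁ ≠ c s₂ ∧
    SupportedFromLeft c s₁ ∧ SupportedFromLeft c s₂ := by
  obtain ⟨s₁, s₂, hne, h1, h2⟩ := hc.exists_two_maxCurvature_eq_curvature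
  refine ⟨s₁, s₂, hne, fun s => ?_, fun s => ?_⟩
  · rw [← h1]
    exact hc.circlineFun_maxCurvature_nonpos s₁ s
  · rw [← h2]
    exact hc.circlineFun_maxCurvature_nonpos s₂ s

theorem curvature_le_of_circlineFun_nonpos {κ t : ℝ}
    (h : ∀ s, circlineFun κ (unitNormal c t) (c t) (c s) ≤ 0) : curvature c t ≤ κ :=
  (hc.curvature_le_maxCurvature t).trans (hc.maxCurvature_le h)

theorem le_curvature_of_circlineFun_nonneg {κ t : ℝ}
    (h : ∀ s, 0 ≤ circlineFun κ (unitNormal c t) (c t) (c s)) : κ ≤ curvature c t := by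
  have := hc.reverse.curvature_le_of_circlineFun_nonpos (κ := -κ) (t := -t) fun s => by
    rw [unitNormal_reverse, neg_neg, circlineFun_neg, neg_nonpos]
    exact h _
  rw [curvature_reverse, neg_neg] at this
  exact neg_le_neg_iff.1 this

/-- The curve then lies on one circline; recentred at `c s`, it supports from both sides, which
squeezes the curvature at `s`. -/
theorem supported_of_supported {t : ℝ} (hl : SupportedFromLeft c t) (hr : SupportedFromRight c t)
    (s : ℝ) : SupportedFromLeft c s ∧ SupportedFromRight c s := by
  have h0 : ∀ r, circlineFun (curvature c t) (unitNormal c t) (c t) (c r) = 0 := fun r =>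
    le_antisymm (hl r) (hr r)
  have h1 := (hc.recenter_eq_unitNormal hl (h0 s)).2
  have h2 : ∀ r, circlineFun (curvature c t) (unitNormal c s) (c s) (c r) = 0 := fun r => by
    rw [h1, h0]
  have hk : curvature c s = curvature c t :=
    le_antisymm (hc.curvature_le_of_circlineFun_nonpos fun r => (h2 r).le)
      (hc.le_curvature_of_circlineFun_nonneg fun r => (h2 r).ge)
  exact ⟨fun r => by rw [hk, h2], fun r => by rw [hk, h2]⟩

theorem exists_four_supported : ∃ s₁ s₂ s₃ s₄, [c s₁, c s₂, c s₃, c s₄].Nodup ∧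
    SupportedFromLeft c s₁ ∧ SupportedFromLeft c s₂ ∧
    SupportedFromRight c s₃ ∧ SupportedFromRight c s₄ := by
  have hℓ := hc.period_pos
  by_cases hex : ∃ t, SupportedFromLeft c t ∧ SupportedFromRight c t
  · obtain ⟨t, hl, hr⟩ := hex
    have hall := hc.supported_of_supported hl hr
    -- On a curve contained in a circline any four points of one period serve.
    refine ⟨3 * ℓ / 4, ℓ / 2, ℓ / 4, 0, ?_, (hall _).1, (hall _).1, (hall _).2, (hall _).2⟩
    have h := fun s t (h1 : t < s) (h2 : s < t + ℓ) => hc.ne_of_mem_Ioo (s := s) (t := t) ⟨h1, h2⟩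
    simp only [List.nodup_cons, List.mem_cons, List.not_mem_nil, or_false, not_or, not_false_eq_true,
      List.nodup_nil, and_true]
    refine ⟨⟨?_, ?_, ?_⟩, ⟨?_, ?_⟩, ?_⟩ <;> apply h <;> linarith
  · obtain ⟨s₁, s₂, h12, h1, h2⟩ := hc.exists_two_supportedFromLeft
    obtain ⟨s₃, s₄, h34, h3, h4⟩ := hc.reverse.exists_two_supportedFromLeft
    rw [supportedFromLeft_reverse_iff] at h3 h4
    have hne : ∀ {s t}, SupportedFromLeft c s → SupportedFromRight c t → c s ≠ c t := by
      intro s t hs ht he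
      refine hex ⟨t, fun r => ?_, ht⟩
      rw [← (hc.curvature_eq_of_eq he).1, ← (hc.curvature_eq_of_eq he).2, ← he]
      exact hs r
    refine ⟨s₁, s₂, -s₃, -s₄, ?_, h1, h2, h3, h4⟩
    simp only [List.nodup_cons, List.mem_cons, List.not_mem_nil, or_false, not_or, not_false_eq_true,
      List.nodup_nil, and_true]
    exact ⟨⟨h12, hne h1 h3, hne h1 h4⟩, ⟨hne h2 h3, hne h2 h4⟩, h34⟩

theorem hasDerivAt_curvature_of_supportedFromRight {t : ℝ} (h : SupportedFromRight c t) :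
    HasDerivAt (curvature c) 0 t := by
  have h1 := hc.reverse.hasDerivAt_curvature_zero (t := -t)
    (supportedFromLeft_reverse_iff.2 (by rwa [neg_neg]))
  have h2 := (h1.scomp t (hasDerivAt_id t).neg).neg
  rw [smul_zero, neg_zero] at h2
  refine h2.congr_of_eventuallyEq (Eventually.of_forall fun s => ?_)
  simp [curvature_reverse]

theorem osculatingSet_subset_of_supportedFromLeft {t : ℝ} (h : SupportedFromLeft c t) :
    osculatingSet c t ⊆ leftSide c ∪ range c := fun x hx => by
  by_cases hxc : x ∈ range c
  · exact Or.inr hxc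
  · exact Or.inl (hc.mem_leftSide_of_circlineFun_nonneg h hxc (Eq.ge hx))

theorem osculatingSet_subset_of_supportedFromRight {t : ℝ} (h : SupportedFromRight c t) :
    osculatingSet c t ⊆ rightSide c ∪ range c := by
  have := hc.reverse.osculatingSet_subset_of_supportedFromLeft (t := -t)
    (supportedFromLeft_reverse_iff.2 (by rwa [neg_neg]))
  rwa [leftSide_reverse, range_reverse, osculatingSet_reverse, neg_neg] at this

theorem exists_region_of_supportedFromLeft {t : ℝ} (h : SupportedFromLeft c t) :
    ∃ x ∈ (osculatingSet c t)ᶜ, range c ⊆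
      connectedComponentIn (osculatingSet c t)ᶜ x ∪ osculatingSet c t := by
  have hn := hc.unitNormal_re_sq_add_im_sq t
  obtain ⟨ε, hε⟩ := (eventually_circlineFun_sub_neg (κ := curvature c t) (p := c t) hn).exists
  have hpre : IsPreconnected {x | circlineFun (curvature c t) (unitNormal c t) (c t) x < 0} := by
    have := isPreconnected_circlineFun_pos (κ := -curvature c t) (n := -unitNormal c t) (p := c t)
      (by simpa using hn)
    simpa only [circlineFun_neg, neg_pos] using this
  have hsub : {x | circlineFun (curvature c t) (unitNormal c t) (c t) x < 0} ⊆
      (osculatingSet c t)ᶜ := fun x hx h0 => (ne_of_lt hx) h0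
  refine ⟨_, hsub hε, ?_⟩
  rintro _ ⟨s, rfl⟩
  rcases (h s).lt_or_eq with h1 | h1
  · exact Or.inl (hpre.subset_connectedComponentIn hε hsub h1)
  · exact Or.inr h1

theorem exists_region_of_supportedFromRight {t : ℝ} (h : SupportedFromRight c t) :
    ∃ x ∈ (osculatingSet c t)ᶜ, range c ⊆
      connectedComponentIn (osculatingSet c t)ᶜ x ∪ osculatingSet c t := by
  have := hc.reverse.exists_region_of_supportedFromLeft (t := -t)
    (supportedFromLeft_reverse_iff.2 (by rwa [neg_neg]))
  rwa [range_reverse, osculatingSet_reverse, neg_neg] at this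

end IsSimpleLoop

end PlaneCurve

/-! ### Transfer from `ℂ` to the Euclidean plane. -/

namespace PlaneCurve

open Set Filter Topology

/-- The plane as the complex plane. -/
noncomputable def toComplex : Plane ≃ₗᵢ[ℝ] ℂ := Complex.orthonormalBasisOneI.repr.symm

theorem toComplex_apply (v : Plane) : toComplex v = v 0 + v 1 * Complex.I :=
  Complex.orthonormalBasisOneI_repr_symm_apply v

theorem toComplex_rotate (v : Plane) : toComplex (rotate v) = Complex.I * toComplex v := by
  rw [toComplex_apply, toComplex_apply, rotate]
  simp
  linear_combination (-(v 1 : ℂ)) * Complex.I_sq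

section Curve

variable (γ : ℝ → Plane) (t : ℝ)

theorem deriv_toComplex_comp (f : ℝ → Plane) :
    deriv (fun t => toComplex (f t)) t = toComplex (deriv f t) :=
  DFunLike.congr_fun (toComplex.toContinuousLinearEquiv.comp_fderiv (f := f) (x := t)) 1

theorem unitTangent_toComplex_comp :
    unitTangent (fun t => toComplex (γ t)) t = toComplex (tangent γ t) := by
  rw [unitTangent, deriv_toComplex_comp, tangent, map_smul, toComplex.norm_map]

theorem unitNormal_toComplex_comp :
    unitNormal (fun t => toComplex (γ t)) t = toComplex (normal γ t) := by
  rw [unitNormal, unitTangent_toComplex_comp, normal, toComplex_rotate]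

theorem curvature_toComplex_comp :
    curvature (fun t => toComplex (γ t)) t = signedCurvature γ t := by
  rw [curvature, funext (unitTangent_toComplex_comp γ), deriv_toComplex_comp, deriv_toComplex_comp,
    unitNormal_toComplex_comp, toComplex.inner_map_map, toComplex.norm_map, signedCurvature]

variable {γ t}

theorem isSimpleLoop_toComplex_comp {ℓ : ℝ} (hγ : IsSimpleClosedSmoothRegularCurve γ ℓ) :
    IsSimpleLoop (fun t => toComplex (γ t)) ℓ where
  smooth := toComplex.contDiff.comp hγ.smooth
  regular t := by
    rw [deriv_toComplex_comp]
    exact (map_ne_zero_iff _ toComplex.injective).2 (hγ.regular t)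
  period_pos := hγ.period_pos
  periodic t := congrArg toComplex (hγ.periodic t)
  simple := toComplex.injective.comp_injOn hγ.simple

theorem image_circline (p T : Plane) (k : ℝ) (hT : ‖T‖ = 1) : toComplex '' circline p T k =
    {x | circlineFun k (Complex.I * toComplex T) (toComplex p) x = 0} := by
  obtain ⟨w, hw⟩ : ∃ w, w = toComplex T := ⟨_, rfl⟩
  have hw1 : w.re ^ 2 + w.im ^ 2 = 1 := by
    have := Complex.sq_norm w
    rw [hw, toComplex.norm_map, hT, ← hw, Complex.normSq_apply] at this
    linarith
  rw [circline]
  split_ifs with hk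
  · rw [← range_comp, hk, ← hw]
    ext x
    simp only [mem_range, Function.comp_apply, map_add, map_smul, ← hw, mem_ofPred_eq, circlineFun,
      Complex.I_mul_re, Complex.I_mul_im]
    constructor
    · rintro ⟨s, rfl⟩
      simp only [Complex.add_re, Complex.add_im, Complex.smul_re, Complex.smul_im, smul_eq_mul]
      ring
    · intro h
      -- The parameter on the line is the orthogonal projection to the unit tangent.
      refine ⟨w.re * (x.re - (toComplex p).re) + w.im * (x.im - (toComplex p).im), ?_⟩
      apply Complex.ext <;>
        simp only [Complex.add_re, Complex.add_im, Complex.smul_re, Complex.smul_im, smul_eq_mul]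
      · linear_combination (x.re - (toComplex p).re) * hw1 + w.im / 2 * h
      · linear_combination (x.im - (toComplex p).im) * hw1 - w.re / 2 * h
  · rw [toComplex.image_sphere, map_add, map_smul, toComplex_rotate, ← hw]
    ext x
    rw [mem_sphere_iff_norm, mem_ofPred_eq, circlineFun_eq_of_ne_zero (by
      simp only [Complex.I_mul_re, Complex.I_mul_im]
      linarith) hk, mul_eq_zero, or_iff_right hk, sub_eq_zero, Complex.real_smul, ← abs_inv,
      sq_eq_sq_iff_abs_eq_abs, abs_of_nonneg (norm_nonneg _)]
    exact eq_comm

theorem image_osculatingCircline {ℓ : ℝ} (hγ : IsSimpleClosedSmoothRegularCurve γ ℓ) (t : ℝ) :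
    toComplex '' osculatingCircline γ t = osculatingSet (fun t => toComplex (γ t)) t := by
  have hT : ‖tangent γ t‖ = 1 := by
    rw [← toComplex.norm_map, ← unitTangent_toComplex_comp]
    exact (isSimpleLoop_toComplex_comp hγ).norm_unitTangent t
  rw [osculatingCircline, image_circline _ _ _ hT, osculatingSet, curvature_toComplex_comp, unitNormal,
    unitTangent_toComplex_comp]

end Curve

theorem image_connectedComponentIn_compl (C : Set Plane) {x : Plane} (hx : x ∈ Cᶜ) :
    toComplex '' connectedComponentIn Cᶜ x =
      connectedComponentIn (toComplex '' C)ᶜ (toComplex x) := by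
  have := toComplex.toHomeomorph.image_connectedComponentIn hx
  rwa [LinearIsometryEquiv.coe_toHomeomorph, image_compl_eq toComplex.bijective] at this

theorem isBounded_image_toComplex {A : Set Plane} :
    Bornology.IsBounded (toComplex '' A) ↔ Bornology.IsBounded A := by
  refine ⟨fun h => ?_, fun h => toComplex.lipschitz.isBounded_image h⟩
  have := toComplex.symm.lipschitz.isBounded_image h
  rwa [← image_comp, toComplex.symm_comp_self, image_id] at this

theorem mem_compl_image_toComplex {C : Set Plane} {x : Plane} :
    toComplex x ∈ (toComplex '' C)ᶜ ↔ x ∈ Cᶜ := by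
  rw [mem_compl_iff, mem_compl_iff, toComplex.injective.mem_set_image]

theorem globallySupportsAt_of_image {σ C : Set Plane} {p : Plane} (hp : p ∈ σ) (hpC : p ∈ C)
    (h : ∃ x ∈ (toComplex '' σ)ᶜ,
      toComplex '' C ⊆ connectedComponentIn (toComplex '' σ)ᶜ x ∪ toComplex '' σ) :
    GloballySupportsAt σ C p := by
  obtain ⟨x, hx, hsub⟩ := h
  obtain ⟨y, rfl⟩ := toComplex.surjective x
  rw [mem_compl_image_toComplex] at hx
  refine ⟨hp, hpC, _, ⟨y, hx, rfl⟩, ?_⟩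
  rwa [← image_connectedComponentIn_compl _ hx, ← image_union,
    image_subset_image_iff toComplex.injective] at hsub

theorem subset_inside_union_of_image {σ C : Set Plane} (h : ∀ x ∈ toComplex '' σ,
    x ∈ (toComplex '' C)ᶜ → Bornology.IsBounded (connectedComponentIn (toComplex '' C)ᶜ x)) :
    σ ⊆ inside C ∪ C := fun x hx => by
  by_cases hxC : x ∈ C
  · exact Or.inr hxC
  · have := h _ (mem_image_of_mem _ hx) (mem_compl_image_toComplex.2 hxC)
    rw [← image_connectedComponentIn_compl _ hxC, isBounded_image_toComplex] at this
    exact Or.inl ⟨hxC, this⟩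

theorem subset_outside_union_of_image {σ C : Set Plane} (h : ∀ x ∈ toComplex '' σ,
    x ∈ (toComplex '' C)ᶜ → ¬ Bornology.IsBounded (connectedComponentIn (toComplex '' C)ᶜ x)) :
    σ ⊆ outside C ∪ C := fun x hx => by
  by_cases hxC : x ∈ C
  · exact Or.inr hxC
  · have := h _ (mem_image_of_mem _ hx) (mem_compl_image_toComplex.2 hxC)
    rw [← image_connectedComponentIn_compl _ hxC, isBounded_image_toComplex] at this
    exact Or.inl ⟨hxC, this⟩

end PlaneCurve

open PlaneCurve in
theorem mainTheorem2 (γ : ℝ → Plane) (ℓ : ℝ) (hγ : IsSimpleClosedSmoothRegularCurve γ ℓ) :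
    (∃ s₁ s₂ s₃ s₄ : ℝ,
      [γ s₁, γ s₂, γ s₃, γ s₄].Nodup ∧
      PlaneCurve.GloballySupportsFromInsideAt
        (PlaneCurve.osculatingCircline γ s₁) (Set.range γ) (γ s₁) ∧
      PlaneCurve.GloballySupportsFromInsideAt
        (PlaneCurve.osculatingCircline γ s₂) (Set.range γ) (γ s₂) ∧
      PlaneCurve.GloballySupportsFromOutsideAt
        (PlaneCurve.osculatingCircline γ s₃) (Set.range γ) (γ s₃) ∧
      PlaneCurve.GloballySupportsFromOutsideAt
        (PlaneCurve.osculatingCircline γ s₄) (Set.range γ) (γ s₄)) ∧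
    (∃ t₁ t₂ t₃ t₄ : ℝ,
      [γ t₁, γ t₂, γ t₃, γ t₄].Nodup ∧
      PlaneCurve.IsVertexAt γ t₁ ∧ PlaneCurve.IsVertexAt γ t₂ ∧
      PlaneCurve.IsVertexAt γ t₃ ∧ PlaneCurve.IsVertexAt γ t₄) := by
  have hc := isSimpleLoop_toComplex_comp hγ
  obtain ⟨s₁, s₂, s₃, s₄, hnodup, h1, h2, h3, h4⟩ := hc.exists_four_supported
  have hnd : [γ s₁, γ s₂, γ s₃, γ s₄].Nodup := List.Nodup.of_map toComplex hnodup
  have hrange : Set.range (fun t => toComplex (γ t)) = toComplex '' Set.range γ :=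
    Set.range_comp toComplex γ
  have hκ : curvature (fun t => toComplex (γ t)) = signedCurvature γ :=
    funext (curvature_toComplex_comp γ)
  have hmem : ∀ t, γ t ∈ osculatingCircline γ t := fun t => by
    rw [← toComplex.injective.mem_set_image, image_osculatingCircline hγ]
    exact circlineFun_self
  have hsl : ∀ {t}, SupportedFromLeft (fun t => toComplex (γ t)) t →
      GloballySupportsAt (osculatingCircline γ t) (Set.range γ) (γ t) := fun {t} ht => by
    refine globallySupportsAt_of_image (hmem t) ⟨t, rfl⟩ ?_
    rw [image_osculatingCircline hγ, ← hrange]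
    exact hc.exists_region_of_supportedFromLeft ht
  have hsr : ∀ {t}, SupportedFromRight (fun t => toComplex (γ t)) t →
      GloballySupportsAt (osculatingCircline γ t) (Set.range γ) (γ t) := fun {t} ht => by
    refine globallySupportsAt_of_image (hmem t) ⟨t, rfl⟩ ?_
    rw [image_osculatingCircline hγ, ← hrange]
    exact hc.exists_region_of_supportedFromRight ht
  have hleft : ∀ {t}, SupportedFromLeft (fun t => toComplex (γ t)) t →
      ∀ x ∈ toComplex '' osculatingCircline γ t, x ∈ (toComplex '' Set.range γ)ᶜ →
      (Bornology.IsBounded (connectedComponentIn (toComplex '' Set.range γ)ᶜ x) ↔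
        Bornology.IsBounded (leftSide fun t => toComplex (γ t))) := fun {t} ht x hx hxC => by
    rw [image_osculatingCircline hγ] at hx
    rw [← hrange] at hxC ⊢
    rw [leftSide_eq ((hc.osculatingSet_subset_of_supportedFromLeft ht hx).resolve_right hxC)]
  have hright : ∀ {t}, SupportedFromRight (fun t => toComplex (γ t)) t →
      ∀ x ∈ toComplex '' osculatingCircline γ t, x ∈ (toComplex '' Set.range γ)ᶜ →
      (Bornology.IsBounded (connectedComponentIn (toComplex '' Set.range γ)ᶜ x) ↔
        Bornology.IsBounded (rightSide fun t => toComplex (γ t))) := fun {t} ht x hx hxC => by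
    rw [image_osculatingCircline hγ] at hx
    rw [← hrange] at hxC ⊢
    rw [rightSide_eq ((hc.osculatingSet_subset_of_supportedFromRight ht hx).resolve_right hxC)]
  refine ⟨?_, s₁, s₂, s₃, s₄, hnd, ?_⟩
  -- The orientation of `γ` is not prescribed: the supports from the left are the inner ones when
  -- the left side is bounded, and the outer ones otherwise.
  · rcases hc.isBounded_sides with ⟨hb, hu⟩ | ⟨hu, hb⟩
    · have hin := fun {t} ht => subset_inside_union_of_image (C := Set.range γ)
        fun x hx hxC => (hleft (t := t) ht x hx hxC).2 hb
      have hout := fun {t} ht => subset_outside_union_of_image (C := Set.range γ)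
        fun x hx hxC h => hu ((hright (t := t) ht x hx hxC).1 h)
      exact ⟨s₁, s₂, s₃, s₄, hnd, ⟨hsl h1, hin h1⟩, ⟨hsl h2, hin h2⟩, ⟨hsr h3, hout h3⟩,
        ⟨hsr h4, hout h4⟩⟩
    · have hin := fun {t} ht => subset_inside_union_of_image (C := Set.range γ)
        fun x hx hxC => (hright (t := t) ht x hx hxC).2 hb
      have hout := fun {t} ht => subset_outside_union_of_image (C := Set.range γ)
        fun x hx hxC h => hu ((hleft (t := t) ht x hx hxC).1 h)
      exact ⟨s₃, s₄, s₁, s₂, (List.perm_append_comm (l₁ := [γ s₁, γ s₂])).nodup_iff.1 hnd,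
        ⟨hsr h3, hin h3⟩, ⟨hsr h4, hin h4⟩, ⟨hsl h1, hout h1⟩, ⟨hsl h2, hout h2⟩⟩
  · simp only [IsVertexAt, ← hκ]
    exact ⟨hc.hasDerivAt_curvature_zero h1, hc.hasDerivAt_curvature_zero h2,
      hc.hasDerivAt_curvature_of_supportedFromRight h3,
      hc.hasDerivAt_curvature_of_supportedFromRight h4⟩
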